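/- **Setting.** Let $E=(E^0,E^1,r,s)$ be a countable directed graph that is row-finite and has no sources, i.e. $r^{-1}(x)$ is finite and nonempty for every $x\in E^0$. Let $G$ be a discrete group acting on $E$ by graph automorphisms, and let $\varphi:G\times E^1\to G$ be a one-cocycle, $\varphi(gh,a)=\varphi(g,ha)\varphi(h,a)$, with $\varphi(g,a)\cdot s(a)=g\cdot s(a)$ for all $g,h\in G$, $a\in E^1$. Finite paths are words $\alpha=a_1\cdots a_n$ with $s(a_i)=r(a_{i+1})$, $r(\alpha)=r(a_1)$, $s(\alpha)=s(a_n)$; vertices are the paths of length $0$; $E^*$ is the set of finite paths and $E^\infty$ the space of one-sided infinite paths $a_1a_2\cdots$, with the topology generated by the cylinders $Z(\alpha)=\alpha E^\infty$. The action and the cocycle extend to paths by $g(a\alpha)=(ga)(\varphi(g,a)\alpha)$ and $\varphi(g,a\alpha)=\varphi(\varphi(g,a),\alpha)$. $\mathcal S_{G,E}$ is the inverse semigroup with zero $\{(\alpha,g,\beta):\alpha,\beta\in E^*,\ g\in G,\ s(\alpha)=g\,s(\beta)\}\cup\{0\}$ with $(\alpha,g,\beta)^*=(\beta,g^{-1},\alpha)$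 and $$(\alpha,g,\beta)(\gamma,h,\delta)=\begin{cases}(\alpha,\,g\,\varphi(h^{-1},\varepsilon)^{-1},\,\delta\,(h^{-1}\varepsilon)) & \beta=\gamma\varepsilon,\\ (\alpha\,(g\varepsilon),\,\varphi(g,\varepsilon)h,\,\delta) & \gamma=\beta\varepsilon,\\ 0 & \text{otherwise.}\end{cases}$$ The standard action $\theta$ of $\mathcal S_{G,E}$ on $E^\infty$ is by the partial homeomorphisms $(\alpha,g,\beta)\cdot\beta\eta=\alpha(g\eta)$ with domain $Z(\beta)$ (and $0$ acts by the empty map). The tight groupoid $\mathcal G_{\rm tight}^{(G,E)}$ is the étale groupoid of germs of the standard action of $\mathcal S_{G,E}$ on the space of tight filters of its semilattice of idempotents. **Locally contracting.** * An inverse semigroup $S$ with zero is locally contracting if for every nonzero idempotent $e$ there are $s\in S$ and a finite set $F=\{f_0,\dots,f_n\}$ of nonzero idempotents such that for all $i$: $f_i\le e\,s^*s$; every nonzero idempotent $h\le s f_i s^*$ satisfies $f_jh\ne0$ for some $j$; and $f_0sf_i=0$. * An action $\theta$ of an inverse semigroup $S$ on a space $X$ by homeomorphisms between open subsets is locally contracting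 if every nonempty open $U\subseteq X$ contains a nonempty open $V$ such that, for some $s\in S$, $\overline V\subseteq\operatorname{dom}\theta_s$ and $\theta_s(\overline V)\subsetneq V$. * An étale groupoid $\mathcal G$ is locally contracting if every nonempty open $U\subseteq\mathcal G^{(0)}$ contains a nonempty open $V$ such that, for some open bisection $B\subseteq\mathcal G$, $\overline V\subseteq B^{-1}B$ and $B\overline VB^{-1}\subsetneq V$ (closure in $\mathcal G^{(0)}$). A $G$-circuit is a pair $(g,\gamma)$ with $g\in G$ and $\gamma\in E^*$ of positive length such that $s(\gamma)=g\,r(\gamma)$; it has an entry if $\gamma=\gamma_1\cdots\gamma_n$ and there are $i$ and an edge $a\ne\gamma_i$ with $r(a)=r(\gamma_i)$. **Theorem.** The following are equivalent: 1. $\mathcal S_{G,E}$ is a locally contracting inverse semigroup. 2. The standard action $\theta$ of $\mathcal S_{G,E}$ on $E^\infty$ is locally contracting. 3. $\mathcal G_{\rm tight}^{(G,E)}$ is a locally contracting groupoid. 4. For every $x\in E^0$ there are $\alpha_x\in E^*$ with $r(\alpha_x)=x$ and a $G$-circuit $(g,\gamma)$ with an entry such that $s(\alpha_x)=r(\gamma)$.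 -/

import Mathlib

open Set Topology

/-- An inverse semigroup with zero: a semigroup with zero and an operation `star` such that
`s * star s * s = s`, `star s * s * star s = star s`, and in which idempotents commute
(equivalently, `star s` is the unique `t` with `s * t * s = s` and `t * s * t = t`). -/
class InverseSemigroup (S : Type*) extends SemigroupWithZero S, Star S where
  regular : ∀ s : S, s * star s * s = s
  star_regular : ∀ s : S, star s * s * star s = star s
  idem_comm : ∀ e f : S, IsIdempotentElem e → IsIdempotentElem f → e * f = f * e

namespace InverseSemigroup

section Basic

variable {S : Type*} [InverseSemigroup S]

lemma idem_star_mul (s : S) : IsIdempotentElem (star s * s) := by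
  unfold IsIdempotentElem
  rw [← mul_assoc, star_regular]

lemma idem_mul_star (s : S) : IsIdempotentElem (s * star s) := by
  unfold IsIdempotentElem
  rw [← mul_assoc, regular]

lemma star_unique {s t : S} (h1 : s * t * s = s) (h2 : t * s * t = t) : t = star s := by
  have it : IsIdempotentElem (t * s) := by unfold IsIdempotentElem; rw [← mul_assoc, h2]
  have it' : IsIdempotentElem (s * t) := by unfold IsIdempotentElem; rw [← mul_assoc, h1]
  have e1 : t * s = star s * s := by
    calc t * s = t * (s * star s * s) := by rw [regular]
      _ = (t * s) * (star s * s) := by simp only [mul_assoc]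
      _ = (star s * s) * (t * s) := idem_comm _ _ it (idem_star_mul s)
      _ = star s * (s * t * s) := by simp only [mul_assoc]
      _ = star s * s := by rw [h1]
  have e2 : s * t = s * star s := by
    calc s * t = (s * star s * s) * t := by rw [regular]
      _ = (s * star s) * (s * t) := by simp only [mul_assoc]
      _ = (s * t) * (s * star s) := idem_comm _ _ (idem_mul_star s) it'
      _ = (s * t * s) * star s := by simp only [mul_assoc]
      _ = s * star s := by rw [h1]
  calc t = t * s * t := h2.symm
    _ = star s * (s * t) := by rw [e1, mul_assoc]
    _ = star s * s * star s := by rw [e2, mul_assoc]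
    _ = star s := star_regular s

lemma star_star' (s : S) : star (star s) = s :=
  (star_unique (star_regular s) (regular s)).symm

lemma star_idem {e : S} (he : IsIdempotentElem e) : star e = e := by
  have h : e * e * e = e := by rw [he.eq, he.eq]
  exact (star_unique h h).symm

lemma idem_mul {e f : S} (he : IsIdempotentElem e) (hf : IsIdempotentElem f) :
    IsIdempotentElem (e * f) := by
  unfold IsIdempotentElem
  calc e * f * (e * f) = e * (f * e) * f := by simp only [mul_assoc]
    _ = (e * e) * (f * f) := by rw [idem_comm f e hf he]; simp only [mul_assoc]
    _ = e * f := by rw [he.eq, hf.eq]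

lemma star_mul_rev (s t : S) : star (s * t) = star t * star s := by
  have c := idem_comm _ _ (idem_mul_star t) (idem_star_mul s)
  refine (star_unique ?_ ?_).symm
  · calc s * t * (star t * star s) * (s * t)
        = s * ((t * star t) * (star s * s)) * t := by simp only [mul_assoc]
      _ = (s * star s * s) * (t * star t * t) := by rw [c]; simp only [mul_assoc]
      _ = s * t := by rw [regular, regular]
  · calc star t * star s * (s * t) * (star t * star s)
        = star t * ((star s * s) * (t * star t)) * star s := by simp only [mul_assoc]
      _ = (star t * t * star t) * (star s * s * star s) := by rw [← c]; simp only [mul_assoc]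
      _ = star t * star s := by rw [star_regular, star_regular]

lemma idem_conj (s : S) {f : S} (hf : IsIdempotentElem f) :
    IsIdempotentElem (star s * f * s) := by
  unfold IsIdempotentElem
  calc star s * f * s * (star s * f * s)
      = star s * (f * (s * star s)) * (f * s) := by simp only [mul_assoc]
    _ = (star s * s * star s) * (f * f) * s := by
        rw [idem_comm f _ hf (idem_mul_star s)]; simp only [mul_assoc]
    _ = star s * f * s := by rw [star_regular, hf.eq]

lemma idem_conj' (s : S) {f : S} (hf : IsIdempotentElem f) :
    IsIdempotentElem (s * f * star s) := by
  have := idem_conj (star s) hf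
  rwa [star_star'] at this

lemma star_zero' : star (0 : S) = 0 := star_idem (mul_zero 0)

/-- `s * f = f' * s` with `f' = s f s*`. -/
lemma mul_idem_eq (s : S) {f : S} (hf : IsIdempotentElem f) :
    s * f = s * f * star s * s := by
  calc s * f = s * star s * s * f := by rw [regular]
    _ = s * ((star s * s) * f) := by simp only [mul_assoc]
    _ = s * f * star s * s := by
      rw [idem_comm _ _ (idem_star_mul s) hf]; simp only [mul_assoc]

lemma idem_mul_eq (s : S) {f : S} (hf : IsIdempotentElem f) :
    f * s = s * (star s * f * s) := by
  calc f * s = f * (s * star s * s) := by rw [regular]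
    _ = (f * (s * star s)) * s := by simp only [mul_assoc]
    _ = s * (star s * f * s) := by
      rw [idem_comm _ _ hf (idem_mul_star s)]; simp only [mul_assoc]

end Basic

/-- A finite set `F` of idempotents is an outer cover of the idempotent `e` when every nonzero
idempotent below `e` meets some element of `F`. The order on idempotents is
`h ≤ e ↔ h * e = h`. -/
def IsOuterCover {S : Type*} [InverseSemigroup S] (F : Finset S) (e : S) : Prop :=
  ∀ h : S, IsIdempotentElem h → h ≠ 0 → h * e = h → ∃ f ∈ F, f * h ≠ 0

/-- Locally contracting inverse semigroups: for every nonzero idempotent `e` there are `s` and a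
finite set `F = {f₀, …, fₙ}` of nonzero idempotents with `fᵢ ≤ e s* s`, with `F` an outer cover of
`s fᵢ s*`, and with `f₀ s fᵢ = 0`, for all `i`. -/
def IsLocallyContracting (S : Type*) [InverseSemigroup S] : Prop :=
  ∀ e : S, IsIdempotentElem e → e ≠ 0 →
    ∃ (s : S) (F : Finset S) (f₀ : S), f₀ ∈ F ∧ ∀ f ∈ F,
      IsIdempotentElem f ∧ f ≠ 0 ∧ f * (e * (star s * s)) = f ∧
      IsOuterCover F (s * f * star s) ∧ f₀ * s * f = 0

end InverseSemigroup

/-- An action of an inverse semigroup with zero on a topological space by homeomorphisms between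
open subsets: `θ (s * t)` is `θ s ∘ θ t` on the largest possible domain, `θ 0` is the empty map,
and the domains cover the space. -/
structure InvSemigroupAction (S X : Type*) [InverseSemigroup S] [TopologicalSpace X] where
  θ : S → OpenPartialHomeomorph X X
  map_mul : ∀ s t : S, θ (s * t) ≈ (θ t).trans (θ s)
  map_zero : (θ 0).source = ∅
  exists_mem : ∀ x : X, ∃ s : S, x ∈ (θ s).source

namespace InvSemigroupAction

open InverseSemigroup

variable {S X : Type*} [InverseSemigroup S] [TopologicalSpace X]

/-- Builds an action from the domains and the maps; the inverse of `act s` is `act (star s)`. -/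
def ofPartial (dom : S → Set X) (act : S → X → X) (hopen : ∀ s, IsOpen (dom s))
    (hcont : ∀ s, ContinuousOn (act s) (dom s))
    (hstar : ∀ s x, x ∈ dom s → act s x ∈ dom (star s) ∧ act (star s) (act s x) = x)
    (hmul : ∀ s t x, x ∈ dom (s * t) ↔ x ∈ dom t ∧ act t x ∈ dom s)
    (hact : ∀ s t x, x ∈ dom t → act t x ∈ dom s → act (s * t) x = act s (act t x))
    (hzero : dom 0 = ∅) (hcov : ∀ x, ∃ s, x ∈ dom s) : InvSemigroupAction S X where
  θ s :=
    { toFun := act s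
      invFun := act (star s)
      source := dom s
      target := dom (star s)
      map_source' := fun x hx => (hstar s x hx).1
      map_target' := fun x hx => by
        have := (hstar (star s) x hx).1
        rwa [star_star'] at this
      left_inv' := fun x hx => (hstar s x hx).2
      right_inv' := fun x hx => by
        have := (hstar (star s) x hx).2
        rwa [star_star'] at this
      open_source := hopen s
      open_target := hopen (star s)
      continuousOn_toFun := hcont s
      continuousOn_invFun := hcont (star s) }
  map_mul s t := by
    refine ⟨?_, ?_⟩
    · ext x
      exact hmul s t x
    · intro x hx
      have := (hmul s t x).1 hx
      exact hact s t x this.1 this.2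
  map_zero := hzero
  exists_mem := hcov

variable (A : InvSemigroupAction S X)

/-- An action is locally contracting when every nonempty open set `U` contains a nonempty open
set `V` such that, for some `s`, the closure of `V` lies in the domain of `θ s` and is mapped by
`θ s` onto a proper subset of `V`. -/
def IsLocallyContracting : Prop :=
  ∀ U : Set X, IsOpen U → U.Nonempty →
    ∃ (V : Set X) (s : S), IsOpen V ∧ V.Nonempty ∧ V ⊆ U ∧
      closure V ⊆ (A.θ s).source ∧ A.θ s '' closure V ⊂ V

lemma mem_mul {s t : S} {x : X} :
    x ∈ (A.θ (s * t)).source ↔ x ∈ (A.θ t).source ∧ A.θ t x ∈ (A.θ s).source := by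
  rw [(A.map_mul s t).1]
  rfl

lemma mul_apply {s t : S} {x : X} (h : x ∈ (A.θ (s * t)).source) :
    A.θ (s * t) x = A.θ s (A.θ t x) :=
  (A.map_mul s t).2 h

lemma idem_apply {e : S} (he : IsIdempotentElem e) {x : X} (hx : x ∈ (A.θ e).source) :
    A.θ e x = x := by
  have h : x ∈ (A.θ (e * e)).source := by rwa [he.eq]
  have h2 := A.mul_apply h
  rw [he.eq] at h2
  exact ((A.θ e).injOn hx (A.mem_mul.1 h).2 h2).symm

lemma mem_star_mul {s : S} {x : X} (hx : x ∈ (A.θ s).source) :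
    x ∈ (A.θ (star s * s)).source := by
  have h : x ∈ (A.θ (s * (star s * s))).source := by
    rw [← mul_assoc, regular]; exact hx
  exact (A.mem_mul.1 h).1

lemma apply_mem_star {s : S} {x : X} (hx : x ∈ (A.θ s).source) :
    A.θ s x ∈ (A.θ (star s)).source := (A.mem_mul.1 (A.mem_star_mul hx)).2

lemma star_apply {s : S} {x : X} (hx : x ∈ (A.θ s).source) :
    A.θ (star s) (A.θ s x) = x := by
  rw [← A.mul_apply (A.mem_star_mul hx), A.idem_apply (idem_star_mul s) (A.mem_star_mul hx)]

lemma mem_mul_idem {s e : S} (he : IsIdempotentElem e) {x : X} :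
    x ∈ (A.θ (s * e)).source ↔ x ∈ (A.θ e).source ∧ x ∈ (A.θ s).source := by
  rw [A.mem_mul]
  constructor
  · rintro ⟨h1, h2⟩
    rw [A.idem_apply he h1] at h2
    exact ⟨h1, h2⟩
  · rintro ⟨h1, h2⟩
    refine ⟨h1, ?_⟩
    rwa [A.idem_apply he h1]

lemma apply_eq_of_germ {s t e : S} (he : IsIdempotentElem e) {x : X} (hx : x ∈ (A.θ e).source)
    (hs : x ∈ (A.θ s).source) (h : s * e = t * e) :
    x ∈ (A.θ t).source ∧ A.θ s x = A.θ t x := by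
  have h1 : x ∈ (A.θ (s * e)).source := (A.mem_mul_idem he).2 ⟨hx, hs⟩
  have h2 : x ∈ (A.θ (t * e)).source := h ▸ h1
  refine ⟨((A.mem_mul_idem he).1 h2).2, ?_⟩
  have a1 := A.mul_apply h1
  have a2 := A.mul_apply h2
  rw [A.idem_apply he hx] at a1 a2
  rw [← a1, ← a2, h]

/-- Pairs `(s, x)` with `x` in the domain of `θ s`. -/
def GermPair : Type _ := {p : S × X // p.2 ∈ (A.θ p.1).source}

/-- `(s, x) ∼ (t, y)` when `x = y` and `s e = t e` for some idempotent `e` whose domain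
contains `x`. -/
def germSetoid : Setoid A.GermPair where
  r p q := p.1.2 = q.1.2 ∧
    ∃ e : S, IsIdempotentElem e ∧ p.1.2 ∈ (A.θ e).source ∧ p.1.1 * e = q.1.1 * e
  iseqv :=
    { refl := fun p => ⟨rfl, star p.1.1 * p.1.1, idem_star_mul _, A.mem_star_mul p.2, rfl⟩
      symm := by
        rintro p q ⟨h, e, he, hx, hpq⟩
        exact ⟨Eq.symm h, e, he, h ▸ hx, Eq.symm hpq⟩
      trans := by
        rintro p q r ⟨h, e, he, hx, hpq⟩ ⟨h', f, hf, hy, hqr⟩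
        refine ⟨Eq.trans h h', e * f, idem_mul he hf, ?_, ?_⟩
        · rw [A.mem_mul_idem hf]
          exact ⟨h ▸ hy, hx⟩
        · rw [← mul_assoc, hpq, mul_assoc, idem_comm e f he hf, ← mul_assoc, hqr, mul_assoc] }

/-- The germs of the action. -/
def Germ : Type _ := Quotient A.germSetoid

/-- The germ `[s, x]`. -/
def germ (s : S) (x : X) (hx : x ∈ (A.θ s).source) : A.Germ :=
  Quotient.mk A.germSetoid ⟨(s, x), hx⟩

lemma germ_eq_iff {s t : S} {x y : X} {hx : x ∈ (A.θ s).source} {hy : y ∈ (A.θ t).source} :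
    A.germ s x hx = A.germ t y hy ↔
      x = y ∧ ∃ e : S, IsIdempotentElem e ∧ x ∈ (A.θ e).source ∧ s * e = t * e :=
  Quotient.eq (r := A.germSetoid)

lemma exists_rep (γ : A.Germ) : ∃ s x, ∃ hx : x ∈ (A.θ s).source, γ = A.germ s x hx := by
  induction γ using Quotient.inductionOn with
  | h p => exact ⟨p.1.1, p.1.2, p.2, rfl⟩

/-- The set `Θ(s, U) = {[s, x] : x ∈ U}`. -/
def Θ (s : S) (U : Set X) : Set A.Germ :=
  {γ | ∃ x ∈ U, ∃ hx : x ∈ (A.θ s).source, γ = A.germ s x hx}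

/-- The topology on the germs generated by the sets `Θ(s, U)`, with `U` an open
subset of the domain of `θ s`. -/
instance : TopologicalSpace A.Germ :=
  TopologicalSpace.generateFrom
    {W | ∃ (s : S) (U : Set X), IsOpen U ∧ U ⊆ (A.θ s).source ∧ W = A.Θ s U}

/-- `[s, x] ↦ x`. -/
def src (γ : A.Germ) : X :=
  Quotient.lift (s := A.germSetoid) (fun p : A.GermPair => p.1.2) (fun _ _ h => And.left h) γ

/-- `[s, x] ↦ θ_s(x)`. -/
def rng (γ : A.Germ) : X :=
  Quotient.lift (fun p : A.GermPair => A.θ p.1.1 p.1.2) (by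
    rintro ⟨⟨s, x⟩, hp⟩ ⟨⟨t, y⟩, hq⟩ ⟨h, e, he, hx, hpq⟩
    simp only at h hx hpq hp hq ⊢
    subst h
    exact (A.apply_eq_of_germ he hx hp hpq).2) γ

@[simp] lemma src_germ {s : S} {x : X} (hx : x ∈ (A.θ s).source) : A.src (A.germ s x hx) = x := rfl

@[simp] lemma rng_germ {s : S} {x : X} (hx : x ∈ (A.θ s).source) :
    A.rng (A.germ s x hx) = A.θ s x := rfl

lemma exists_unit (x : X) : ∃ e : S, IsIdempotentElem e ∧ x ∈ (A.θ e).source := by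
  obtain ⟨s, hs⟩ := A.exists_mem x
  exact ⟨_, idem_star_mul s, A.mem_star_mul hs⟩

/-- The unit at `x`: the germ `[e, x]`, for any idempotent `e` whose domain contains `x`. -/
noncomputable def unit (x : X) : A.Germ :=
  A.germ (A.exists_unit x).choose x (A.exists_unit x).choose_spec.2

lemma unit_eq {e : S} (he : IsIdempotentElem e) {x : X} (hx : x ∈ (A.θ e).source) :
    A.unit x = A.germ e x hx := by
  obtain ⟨h1, h2⟩ := (A.exists_unit x).choose_spec
  refine A.germ_eq_iff.2 ⟨rfl, _, idem_mul h1 he, (A.mem_mul_idem he).2 ⟨hx, h2⟩, ?_⟩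
  rw [← mul_assoc, h1.eq, idem_comm _ _ h1 he, ← mul_assoc, he.eq]

/-- The inverse `[s, x]⁻¹ = [s*, θ_s(x)]`. -/
def inv (γ : A.Germ) : A.Germ :=
  Quotient.lift (fun p : A.GermPair =>
    A.germ (star p.1.1) (A.θ p.1.1 p.1.2) (A.apply_mem_star p.2)) (by
    rintro ⟨⟨s, x⟩, hp⟩ ⟨⟨t, y⟩, hq⟩ ⟨h, e, he, hx, hpq⟩
    simp only at h hx hpq hp hq ⊢
    subst h
    have key := (A.apply_eq_of_germ he hx hp hpq).2
    refine A.germ_eq_iff.2 ⟨key, s * e * star s, idem_conj' s he, ?_, ?_⟩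
    · rw [A.mem_mul, A.star_apply hp, A.mem_mul_idem he]
      exact ⟨A.apply_mem_star hp, hx, hp⟩
    · have h1 : s * e * star s = t * e * star t := by
        calc s * e * star s = (s * e) * star (s * e) := by
              rw [star_mul_rev, star_idem he, ← mul_assoc, mul_assoc s e e, he.eq]
          _ = (t * e) * star (t * e) := by rw [hpq]
          _ = t * e * star t := by
              rw [star_mul_rev, star_idem he, ← mul_assoc, mul_assoc t e e, he.eq]
      have h2 : ∀ u : S, star u * (u * e * star u) = e * star u := by
        intro u
        calc star u * (u * e * star u) = (star u * u) * e * star u := by simp only [mul_assoc]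
          _ = e * (star u * u * star u) := by
              rw [idem_comm _ _ (idem_star_mul u) he]; simp only [mul_assoc]
          _ = e * star u := by rw [star_regular]
      have h3 : e * star s = e * star t := by
        have := congrArg star hpq
        rwa [star_mul_rev, star_mul_rev, star_idem he] at this
      rw [h2, h1, h2, h3]) γ

@[simp] lemma inv_germ {s : S} {x : X} (hx : x ∈ (A.θ s).source) :
    A.inv (A.germ s x hx) = A.germ (star s) (A.θ s x) (A.apply_mem_star hx) := rfl

lemma mul_wd {s s' t t' e f : S} {y : X} (he : IsIdempotentElem e) (hf : IsIdempotentElem f)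
    (hy : y ∈ (A.θ t).source) (hye : A.θ t y ∈ (A.θ e).source) (hyf : y ∈ (A.θ f).source)
    (hs : s * e = s' * e) (ht : t * f = t' * f) :
    ∃ h : S, IsIdempotentElem h ∧ y ∈ (A.θ h).source ∧ s * t * h = s' * t' * h := by
  have hfu : ∀ v : S, f * (star (v * f) * e * (v * f)) = star (v * f) * e * (v * f) := by
    intro v
    rw [star_mul_rev, star_idem hf]
    simp only [← mul_assoc]
    rw [hf.eq]
  have hu : ∀ v : S, v * (star (v * f) * e * (v * f)) = e * (v * f) := by
    intro v
    calc v * (star (v * f) * e * (v * f))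
        = v * (f * (star (v * f) * e * (v * f))) := by rw [hfu]
      _ = (v * f) * (star (v * f) * e * (v * f)) := by simp only [mul_assoc]
      _ = e * (v * f) := (idem_mul_eq _ he).symm
  have hm : y ∈ (A.θ (t * f)).source := (A.mem_mul_idem hf).2 ⟨hyf, hy⟩
  have hv : A.θ (t * f) y = A.θ t y := by rw [A.mul_apply hm, A.idem_apply hf hyf]
  refine ⟨star (t * f) * e * (t * f), idem_conj _ he, ?_, ?_⟩
  · refine A.mem_mul.2 ⟨hm, ?_⟩
    rw [hv, A.mem_mul, A.idem_apply he hye]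
    exact ⟨hye, hv ▸ A.apply_mem_star hm⟩
  · rw [mul_assoc, hu, ← mul_assoc, hs, mul_assoc, mul_assoc]
    conv_rhs => rw [ht, hu]
    rw [ht]

/-- The product `[s, θ_t(x)] [t, x] = [s t, x]`. -/
noncomputable def mul (a b : A.Germ) (h : A.src a = A.rng b) : A.Germ :=
  A.germ (a.out.1.1 * b.out.1.1) b.out.1.2 (by
    have ha : A.src a = a.out.1.2 := congrArg A.src (Quotient.out_eq a).symm
    have hb : A.rng b = A.θ b.out.1.1 b.out.1.2 := congrArg A.rng (Quotient.out_eq b).symm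
    rw [A.mem_mul, ← hb, ← h, ha]
    exact ⟨b.out.2, a.out.2⟩)

lemma mul_germ {s t : S} {x y : X} (hx : x ∈ (A.θ s).source) (hy : y ∈ (A.θ t).source)
    (h : x = A.θ t y) :
    A.mul (A.germ s x hx) (A.germ t y hy) h =
      A.germ (s * t) y (A.mem_mul.2 ⟨hy, h ▸ hx⟩) := by
  obtain ⟨h1, e, he, hxe, hse⟩ := Quotient.mk_out (s := A.germSetoid) ⟨(s, x), hx⟩
  obtain ⟨h2, f, hf, hyf, htf⟩ := Quotient.mk_out (s := A.germSetoid) ⟨(t, y), hy⟩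
  simp only at h1 h2 hse htf
  rw [h1] at hxe
  rw [h2] at hyf
  obtain ⟨k, hk, hyk, e1⟩ := A.mul_wd he hf hy (h ▸ hxe) hyf hse.symm htf.symm
  refine A.germ_eq_iff.2 ⟨h2, k, hk, ?_, e1.symm⟩
  exact h2.symm ▸ hyk

lemma isOpen_Θ (s : S) {U : Set X} (hU : IsOpen U) (hs : U ⊆ (A.θ s).source) :
    IsOpen (A.Θ s U) :=
  TopologicalSpace.isOpen_generateFrom_of_mem ⟨s, U, hU, hs, rfl⟩

lemma exists_Θ_subset {W : Set A.Germ} (hW : IsOpen W) {s : S} {x : X}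
    (hx : x ∈ (A.θ s).source) (h : A.germ s x hx ∈ W) :
    ∃ U : Set X, IsOpen U ∧ U ⊆ (A.θ s).source ∧ x ∈ U ∧ A.Θ s U ⊆ W := by
  induction hW with
  | basic W hW =>
    obtain ⟨t, V, hV, hVt, rfl⟩ := hW
    obtain ⟨y, hyV, hy, hxy⟩ := h
    obtain ⟨rfl, e, he, hxe, hst⟩ := A.germ_eq_iff.1 hxy
    refine ⟨V ∩ (A.θ s).source ∩ (A.θ e).source,
      (hV.inter (A.θ s).open_source).inter (A.θ e).open_source,
      fun z hz => hz.1.2, ⟨⟨hyV, hx⟩, hxe⟩, ?_⟩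
    rintro _ ⟨z, ⟨⟨hzV, hzs⟩, hze⟩, hz, rfl⟩
    exact ⟨z, hzV, hVt hzV, A.germ_eq_iff.2 ⟨rfl, e, he, hze, hst⟩⟩
  | univ => exact ⟨_, (A.θ s).open_source, subset_rfl, hx, subset_univ _⟩
  | inter W₁ W₂ _ _ ih₁ ih₂ =>
    obtain ⟨U₁, a₁, b₁, c₁, d₁⟩ := ih₁ h.1
    obtain ⟨U₂, a₂, b₂, c₂, d₂⟩ := ih₂ h.2
    refine ⟨U₁ ∩ U₂, a₁.inter a₂, fun z hz => b₁ hz.1, ⟨c₁, c₂⟩, ?_⟩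
    rintro _ ⟨z, hz, hz', rfl⟩
    exact ⟨d₁ ⟨z, hz.1, hz', rfl⟩, d₂ ⟨z, hz.2, hz', rfl⟩⟩
  | sUnion 𝒲 _ ih =>
    obtain ⟨W, hW, hxW⟩ := h
    obtain ⟨U, a, b, c, d⟩ := ih W hW hxW
    exact ⟨U, a, b, c, d.trans (subset_sUnion_of_mem hW)⟩

lemma continuous_src : Continuous A.src := by
  refine continuous_def.2 fun U hU => isOpen_iff_forall_mem_open.2 fun γ hγ => ?_
  obtain ⟨s, x, hx, rfl⟩ := A.exists_rep γ
  refine ⟨A.Θ s (U ∩ (A.θ s).source), ?_, A.isOpen_Θ s (hU.inter (A.θ s).open_source)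
    inter_subset_right, ⟨x, ⟨hγ, hx⟩, hx, rfl⟩⟩
  rintro _ ⟨z, hz, hz', rfl⟩
  exact hz.1

lemma isOpenMap_src : IsOpenMap A.src := by
  intro W hW
  refine isOpen_iff_forall_mem_open.2 ?_
  rintro _ ⟨γ, hγ, rfl⟩
  obtain ⟨s, x, hx, rfl⟩ := A.exists_rep γ
  obtain ⟨U, hU, hUs, hxU, hUW⟩ := A.exists_Θ_subset hW hx hγ
  exact ⟨U, fun z hz => ⟨A.germ s z (hUs hz), hUW ⟨z, hz, hUs hz, rfl⟩, rfl⟩, hU, hxU⟩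

end InvSemigroupAction

/-- An étale topological groupoid with arrow space `Γ` and unit space (a copy of) `X`, embedded in
`Γ` as an open subspace by `unit`; the product `a b` is defined when `src a = rng b`. -/
structure EtaleGroupoid (X Γ : Type*) [TopologicalSpace X] [TopologicalSpace Γ] where
  src : Γ → X
  rng : Γ → X
  unit : X → Γ
  inv : Γ → Γ
  mul : ∀ a b : Γ, src a = rng b → Γ
  src_unit : ∀ x, src (unit x) = x
  rng_unit : ∀ x, rng (unit x) = x
  src_inv : ∀ a, src (inv a) = rng a
  rng_inv : ∀ a, rng (inv a) = src a
  src_mul : ∀ a b h, src (mul a b h) = src b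
  rng_mul : ∀ a b h, rng (mul a b h) = rng a
  mul_assoc : ∀ a b c (h₁ : src a = rng b) (h₂ : src b = rng c),
    mul (mul a b h₁) c ((src_mul a b h₁).trans h₂) =
      mul a (mul b c h₂) (h₁.trans (rng_mul b c h₂).symm)
  mul_unit : ∀ a, mul a (unit (src a)) (rng_unit _).symm = a
  unit_mul : ∀ a, mul (unit (rng a)) a (src_unit _) = a
  mul_inv : ∀ a, mul a (inv a) (rng_inv a).symm = unit (rng a)
  inv_mul : ∀ a, mul (inv a) a (src_inv a) = unit (src a)
  continuous_mul : Continuous fun p : {p : Γ × Γ // src p.1 = rng p.2} => mul p.1.1 p.1.2 p.2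
  continuous_inv : Continuous inv
  isOpenEmbedding_unit : IsOpenEmbedding unit
  isLocalHomeomorph_src : IsLocalHomeomorph src

namespace EtaleGroupoid

variable {X Γ : Type*} [TopologicalSpace X] [TopologicalSpace Γ] (𝒢 : EtaleGroupoid X Γ)

/-- The product `A B = {a b : a ∈ A, b ∈ B, a b defined}` of two sets of arrows. -/
def mulSet (A B : Set Γ) : Set Γ :=
  {c | ∃ a ∈ A, ∃ b ∈ B, ∃ h : 𝒢.src a = 𝒢.rng b, c = 𝒢.mul a b h}

/-- Open bisections: open sets of arrows on which source and range are injective. -/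
def IsOpenBisection (B : Set Γ) : Prop :=
  IsOpen B ∧ InjOn 𝒢.src B ∧ InjOn 𝒢.rng B

/-- A locally contracting groupoid: every nonempty open set `U` of units contains a nonempty open
set `V` of units such that, for some open bisection `B`, one has `V̄ ⊆ B⁻¹ B` and
`B V̄ B⁻¹ ⊊ V`, the closure being taken in the unit space. -/
def IsLocallyContracting : Prop :=
  ∀ U : Set X, IsOpen U → U.Nonempty →
    ∃ (V : Set X) (B : Set Γ), IsOpen V ∧ V.Nonempty ∧ V ⊆ U ∧ 𝒢.IsOpenBisection B ∧
      𝒢.unit '' closure V ⊆ 𝒢.mulSet (𝒢.inv '' B) B ∧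
      𝒢.mulSet (𝒢.mulSet B (𝒢.unit '' closure V)) (𝒢.inv '' B) ⊂ 𝒢.unit '' V

end EtaleGroupoid

namespace InvSemigroupAction

open InverseSemigroup

variable {S X : Type*} [InverseSemigroup S] [TopologicalSpace X] (A : InvSemigroupAction S X)

lemma mul_eq {a b : A.Germ} {s t : S} {x y : X} {hx : x ∈ (A.θ s).source}
    {hy : y ∈ (A.θ t).source} (ha : a = A.germ s x hx) (hb : b = A.germ t y hy)
    (h : A.src a = A.rng b) : ∃ hm, A.mul a b h = A.germ (s * t) y hm := by
  subst ha hb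
  exact ⟨_, A.mul_germ hx hy h⟩

lemma germ_congr {s t : S} {x : X} {hx : x ∈ (A.θ s).source} {ht : x ∈ (A.θ t).source}
    (h : s = t) : A.germ s x hx = A.germ t x ht := by
  subst h
  rfl

lemma src_unit (x : X) : A.src (A.unit x) = x := rfl

lemma rng_unit (x : X) : A.rng (A.unit x) = x :=
  A.idem_apply (A.exists_unit x).choose_spec.1 (A.exists_unit x).choose_spec.2

lemma src_inv (a : A.Germ) : A.src (A.inv a) = A.rng a := by
  obtain ⟨s, x, hx, rfl⟩ := A.exists_rep a
  rfl

lemma rng_inv (a : A.Germ) : A.rng (A.inv a) = A.src a := by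
  obtain ⟨s, x, hx, rfl⟩ := A.exists_rep a
  exact A.star_apply hx

lemma src_mul (a b : A.Germ) (h) : A.src (A.mul a b h) = A.src b := by
  obtain ⟨s, x, hx, rfl⟩ := A.exists_rep a
  obtain ⟨t, y, hy, rfl⟩ := A.exists_rep b
  rw [A.mul_germ hx hy h]
  rfl

lemma rng_mul (a b : A.Germ) (h) : A.rng (A.mul a b h) = A.rng a := by
  obtain ⟨s, x, hx, rfl⟩ := A.exists_rep a
  obtain ⟨t, y, hy, rfl⟩ := A.exists_rep b
  obtain ⟨hm, e⟩ := A.mul_eq rfl rfl h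
  have h' : x = A.θ t y := h
  rw [e, A.rng_germ, A.mul_apply hm, A.rng_germ, h']

/-- The groupoid of germs of an action of an inverse semigroup. -/
noncomputable def germGroupoid : EtaleGroupoid X A.Germ where
  src := A.src
  rng := A.rng
  unit := A.unit
  inv := A.inv
  mul := A.mul
  src_unit := A.src_unit
  rng_unit := A.rng_unit
  src_inv := A.src_inv
  rng_inv := A.rng_inv
  src_mul := A.src_mul
  rng_mul := A.rng_mul
  mul_assoc a b c h₁ h₂ := by
    obtain ⟨s, x, hx, rfl⟩ := A.exists_rep a
    obtain ⟨t, y, hy, rfl⟩ := A.exists_rep b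
    obtain ⟨u, z, hz, rfl⟩ := A.exists_rep c
    obtain ⟨m₁, e₁⟩ := A.mul_eq rfl rfl h₁
    obtain ⟨m₂, e₂⟩ := A.mul_eq rfl rfl h₂
    obtain ⟨m₃, e₃⟩ := A.mul_eq e₁ rfl ((A.src_mul _ _ h₁).trans h₂)
    obtain ⟨m₄, e₄⟩ := A.mul_eq rfl e₂ (h₁.trans (A.rng_mul _ _ h₂).symm)
    rw [e₃, e₄]
    exact A.germ_congr (_root_.mul_assoc s t u)
  mul_unit a := by
    obtain ⟨s, x, hx, rfl⟩ := A.exists_rep a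
    obtain ⟨m, e⟩ := A.mul_eq (rfl : A.germ s x hx = _)
      (A.unit_eq (idem_star_mul s) (A.mem_star_mul hx)) (A.rng_unit x).symm
    refine e.trans (A.germ_congr ?_)
    rw [← _root_.mul_assoc, regular]
  unit_mul a := by
    obtain ⟨s, x, hx, rfl⟩ := A.exists_rep a
    have e : A.unit (A.θ s x) = A.germ (s * star s) (A.θ s x)
        (A.mem_mul.2 ⟨A.apply_mem_star hx, by rwa [A.star_apply hx]⟩) :=
      A.unit_eq (idem_mul_star s) _
    obtain ⟨m, e⟩ := A.mul_eq e (rfl : A.germ s x hx = _) (A.src_unit _)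
    exact e.trans (A.germ_congr (regular s))
  mul_inv a := by
    obtain ⟨s, x, hx, rfl⟩ := A.exists_rep a
    obtain ⟨m, e⟩ := A.mul_eq (rfl : A.germ s x hx = _) (A.inv_germ hx) (A.rng_inv _).symm
    exact e.trans (A.unit_eq (idem_mul_star s) _).symm
  inv_mul a := by
    obtain ⟨s, x, hx, rfl⟩ := A.exists_rep a
    obtain ⟨m, e⟩ := A.mul_eq (A.inv_germ hx) (rfl : A.germ s x hx = _) (A.src_inv _)
    exact e.trans (A.unit_eq (idem_star_mul s) _).symm
  continuous_mul := by
    refine continuous_def.2 fun W hW => isOpen_iff_forall_mem_open.2 ?_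
    rintro ⟨⟨a, b⟩, hab⟩ h
    obtain ⟨s, x, hx, rfl⟩ := A.exists_rep a
    obtain ⟨t, y, hy, rfl⟩ := A.exists_rep b
    have h' : A.mul (A.germ s x hx) (A.germ t y hy) hab ∈ W := h
    rw [A.mul_germ hx hy hab] at h'
    obtain ⟨U, hU, hUs, hyU, hUW⟩ := A.exists_Θ_subset hW _ h'
    have hUt : U ⊆ (A.θ t).source := fun z hz => (A.mem_mul.1 (hUs hz)).1
    refine ⟨{p | p.1.1 ∈ A.Θ s (A.θ s).source ∧ p.1.2 ∈ A.Θ t U}, ?_, ?_, ?_⟩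
    · rintro ⟨⟨a, b⟩, hab'⟩ ⟨⟨x', -, hx', ha⟩, ⟨y', hyU', hy', hb⟩⟩
      simp only at ha hb hab'
      subst ha hb
      change A.mul _ _ hab' ∈ W
      rw [A.mul_germ hx' hy' hab']
      exact hUW ⟨y', hyU', _, rfl⟩
    · exact ((A.isOpen_Θ s (A.θ s).open_source subset_rfl).preimage
        (continuous_fst.comp continuous_subtype_val)).inter
        ((A.isOpen_Θ t hU hUt).preimage (continuous_snd.comp continuous_subtype_val))
    · exact ⟨⟨x, hx, hx, rfl⟩, ⟨y, hyU, hy, rfl⟩⟩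
  continuous_inv := by
    refine continuous_def.2 fun W hW => isOpen_iff_forall_mem_open.2 fun a h => ?_
    obtain ⟨s, x, hx, rfl⟩ := A.exists_rep a
    obtain ⟨U, hU, hUs, hxU, hUW⟩ := A.exists_Θ_subset hW (A.apply_mem_star hx) h
    refine ⟨A.Θ s ((A.θ s).source ∩ A.θ s ⁻¹' U), ?_, A.isOpen_Θ s
      ((A.θ s).continuousOn.isOpen_inter_preimage (A.θ s).open_source hU) inter_subset_left,
      ⟨x, ⟨hx, hxU⟩, hx, rfl⟩⟩
    rintro _ ⟨z, hz, hz', rfl⟩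
    exact hUW ⟨A.θ s z, hz.2, A.apply_mem_star hz', rfl⟩
  isOpenEmbedding_unit := by
    refine .of_continuous_injective_isOpenMap ?_ ?_ ?_
    · refine continuous_def.2 fun W hW => isOpen_iff_forall_mem_open.2 fun x h => ?_
      obtain ⟨e, he, hx⟩ := A.exists_unit x
      have h' : A.unit x ∈ W := h
      rw [A.unit_eq he hx] at h'
      obtain ⟨U, hU, hUs, hxU, hUW⟩ := A.exists_Θ_subset hW hx h'
      refine ⟨U, fun z hz => ?_, hU, hxU⟩
      exact hUW ⟨z, hz, hUs hz, A.unit_eq he (hUs hz)⟩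
    · intro x y h
      have := congrArg A.src h
      rwa [A.src_unit, A.src_unit] at this
    · intro U hU
      refine isOpen_iff_forall_mem_open.2 ?_
      rintro _ ⟨x, hxU, rfl⟩
      obtain ⟨e, he, hx⟩ := A.exists_unit x
      refine ⟨A.Θ e (U ∩ (A.θ e).source), ?_, A.isOpen_Θ e (hU.inter (A.θ e).open_source)
        inter_subset_right, ⟨x, ⟨hxU, hx⟩, hx, A.unit_eq he hx⟩⟩
      rintro _ ⟨z, hz, hz', rfl⟩
      exact ⟨z, hz.1, A.unit_eq he hz'⟩
  isLocalHomeomorph_src := by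
    refine isLocalHomeomorph_iff_isOpenEmbedding_restrict.2 fun a => ?_
    obtain ⟨s, x, hx, rfl⟩ := A.exists_rep a
    have hO := A.isOpen_Θ s (A.θ s).open_source subset_rfl
    refine ⟨A.Θ s (A.θ s).source, hO.mem_nhds ⟨x, hx, hx, rfl⟩, ?_⟩
    refine .of_continuous_injective_isOpenMap A.continuous_src.continuousOn.domRestrict ?_
      (A.isOpenMap_src.domRestrict hO)
    intro p q hpq
    obtain ⟨y, _, hy, hp⟩ := p.2
    obtain ⟨z, _, hz, hq⟩ := q.2
    have h : A.src p.1 = A.src q.1 := hpq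
    rw [hp, hq] at h
    have hyz : y = z := h
    subst hyz
    exact Subtype.ext (hp.trans hq.symm)

end InvSemigroupAction

namespace InverseSemigroup

/-- For sets `X`, `Y` of idempotents, the idempotents `e` with `e ≤ x` for all `x ∈ X` and
`e ⊥ y` (that is, `e * y = 0`) for all `y ∈ Y`. -/
def idemBetween {S : Type*} [InverseSemigroup S] (X Y : Set S) : Set S :=
  {e | IsIdempotentElem e ∧ (∀ x ∈ X, e * x = e) ∧ ∀ y ∈ Y, e * y = 0}

/-- `Z` is a cover of the set `W` of idempotents: `Z ⊆ W`, and every nonzero element of `W`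
meets some element of `Z`. -/
def IsCover {S : Type*} [InverseSemigroup S] (Z W : Set S) : Prop :=
  Z ⊆ W ∧ ∀ e ∈ W, e ≠ 0 → ∃ z ∈ Z, z * e ≠ 0

/-- Tight filters of the semilattice of idempotents of `S`: nonempty filters `ξ` not containing
`0` such that, whenever `X ⊆ ξ` and `Y ∩ ξ = ∅` are finite, `ξ` meets every finite cover of the set
of idempotents below all of `X` and orthogonal to all of `Y`. -/
structure TightFilter (S : Type*) [InverseSemigroup S] where
  carrier : Set S
  idem : ∀ e ∈ carrier, IsIdempotentElem e
  nonempty : carrier.Nonempty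
  zero_notMem : (0 : S) ∉ carrier
  mul_mem : ∀ e ∈ carrier, ∀ f ∈ carrier, e * f ∈ carrier
  mem_of_le : ∀ e ∈ carrier, ∀ f : S, IsIdempotentElem f → e * f = e → f ∈ carrier
  tight : ∀ X Y Z : Set S, X.Finite → Y.Finite → Z.Finite → X ⊆ carrier →
    (∀ y ∈ Y, IsIdempotentElem y) → Disjoint Y carrier → IsCover Z (idemBetween X Y) →
    (Z ∩ carrier).Nonempty

namespace TightFilter

variable {S : Type*} [InverseSemigroup S]

lemma ext' {ξ η : TightFilter S} (h : ξ.carrier = η.carrier) : ξ = η := by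
  cases ξ; cases η; simp only at h; subst h; rfl

/-- The topology of pointwise convergence of characteristic functions. -/
instance : TopologicalSpace (TightFilter S) :=
  TopologicalSpace.generateFrom
    {U | ∃ e : S, U = {ξ | e ∈ ξ.carrier} ∨ U = {ξ | e ∉ ξ.carrier}}

/-- Conjugating a tight filter `ξ ∋ s* s` by `s`: the filter `{f : s* f s ∈ ξ}`, which is
generated by the elements `s e s*` with `e ∈ ξ`. -/
def conj (s : S) (ξ : TightFilter S) (h : star s * s ∈ ξ.carrier) : TightFilter S where
  carrier := {f | IsIdempotentElem f ∧ star s * f * s ∈ ξ.carrier}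
  idem f hf := hf.1
  nonempty := ⟨s * star s, idem_mul_star s, by rwa [← mul_assoc, star_regular]⟩
  zero_notMem := by
    rintro ⟨-, h0⟩
    rw [mul_zero, zero_mul] at h0
    exact ξ.zero_notMem h0
  mul_mem := by
    rintro e ⟨he, he'⟩ f ⟨hf, hf'⟩
    refine ⟨idem_mul he hf, ?_⟩
    have := ξ.mul_mem _ he' _ hf'
    have h2 : star s * e * s * (star s * f * s) = star s * (e * f) * s := by
      calc star s * e * s * (star s * f * s)
          = star s * e * (s * (star s * f * s)) := by simp only [mul_assoc]
        _ = star s * (e * f) * s := by rw [← idem_mul_eq s hf]; simp only [mul_assoc]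
    rwa [h2] at this
  mem_of_le := by
    rintro e ⟨he, he'⟩ f hf hef
    refine ⟨hf, ξ.mem_of_le _ he' _ (idem_conj s hf) ?_⟩
    calc star s * e * s * (star s * f * s)
        = star s * e * (s * (star s * f * s)) := by simp only [mul_assoc]
      _ = star s * (e * f) * s := by rw [← idem_mul_eq s hf]; simp only [mul_assoc]
      _ = star s * e * s := by rw [hef]
  tight := by
    intro X Y Z hX hY hZ hXs hYi hYd hZc
    have hXi : ∀ x ∈ X, IsIdempotentElem x := fun x hx => (hXs hx).1
    have hZi : ∀ z ∈ Z, IsIdempotentElem z := fun z hz => (hZc.1 hz).1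
    have key : ∀ e f : S, IsIdempotentElem f →
        star s * e * s * (star s * f * s) = star s * (e * f) * s := by
      intro e f hf
      calc star s * e * s * (star s * f * s)
          = star s * e * (s * (star s * f * s)) := by simp only [mul_assoc]
        _ = star s * (e * f) * s := by rw [← idem_mul_eq s hf]; simp only [mul_assoc]
    have hss : ∀ e : S, star s * e * s * (star s * s) = star s * e * s := by
      intro e
      calc star s * e * s * (star s * s) = star s * e * (s * star s * s) := by
            simp only [mul_assoc]
        _ = star s * e * s := by rw [regular]
    obtain ⟨w, ⟨z, hz, rfl⟩, hzξ⟩ := ξ.tight (insert (star s * s) ((fun x => star s * x * s) '' X))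
      ((fun y => star s * y * s) '' Y) ((fun z => star s * z * s) '' Z)
      ((hX.image _).insert _) (hY.image _) (hZ.image _) (by
        rintro _ (rfl | ⟨x, hx, rfl⟩)
        · exact h
        · exact (hXs hx).2) (by
        rintro _ ⟨y, hy, rfl⟩
        exact idem_conj s (hYi y hy)) (by
        refine Set.disjoint_left.2 ?_
        rintro _ ⟨y, hy, rfl⟩ hyξ
        exact Set.disjoint_left.1 hYd hy ⟨hYi y hy, hyξ⟩) (by
        refine ⟨?_, ?_⟩
        · rintro _ ⟨z, hz, rfl⟩
          obtain ⟨h1, h2, h3⟩ := hZc.1 hz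
          refine ⟨idem_conj s h1, ?_, ?_⟩
          · rintro _ (rfl | ⟨x, hx, rfl⟩)
            · exact hss z
            · simp only [key z x (hXi x hx), h2 x hx]
          · rintro _ ⟨y, hy, rfl⟩
            simp only [key z y (hYi y hy), h3 y hy, mul_zero, zero_mul]
        · rintro e ⟨he, hle, hperp⟩ he0
          have hes : e * (star s * s) = e := hle _ (Set.mem_insert _ _)
          have hse : star s * s * e = e := by rw [idem_comm _ _ (idem_star_mul s) he, hes]
          have hback : star s * (s * e * star s) * s = e := by
            calc star s * (s * e * star s) * s = star s * s * e * (star s * s) := by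
                  simp only [mul_assoc]
              _ = e := by rw [hse, hes]
          have hcv : ∀ f : S, IsIdempotentElem f →
              s * e * star s * f = s * (e * (star s * f * s)) * star s := by
            intro f hf
            calc s * e * star s * f = s * e * (star s * s * star s) * f := by rw [star_regular]
              _ = s * e * star s * ((s * star s) * f) := by simp only [mul_assoc]
              _ = s * e * star s * (f * (s * star s)) := by
                  rw [idem_comm _ _ (idem_mul_star s) hf]
              _ = s * (e * (star s * f * s)) * star s := by simp only [mul_assoc]
          obtain ⟨z, hz, hze⟩ := hZc.2 (s * e * star s) ⟨idem_conj' s he, by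
              intro x hx
              rw [hcv x (hXi x hx), hle _ (Set.mem_insert_of_mem _ ⟨x, hx, rfl⟩)], by
              intro y hy
              rw [hcv y (hYi y hy), hperp _ ⟨y, hy, rfl⟩, mul_zero, zero_mul]⟩ (by
              intro h0
              rw [h0, mul_zero, zero_mul] at hback
              exact he0 hback.symm)
          refine ⟨_, ⟨z, hz, rfl⟩, fun h0 => hze ?_⟩
          rw [idem_comm _ _ (hZi z hz) (idem_conj' s he), hcv z (hZi z hz),
            idem_comm _ _ he (idem_conj s (hZi z hz))]
          simp only at h0
          rw [h0, mul_zero, zero_mul])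
    exact ⟨z, hz, hZi z hz, hzξ⟩

open Classical in
/-- The standard action of `S` on the space of tight filters: `s` maps a tight filter `ξ ∋ s* s`
to the tight filter generated by `s ξ s*`. -/
noncomputable def action (S : Type*) [InverseSemigroup S] :
    InvSemigroupAction S (TightFilter S) :=
  InvSemigroupAction.ofPartial
    (fun s => {ξ | star s * s ∈ ξ.carrier})
    (fun s ξ => if h : star s * s ∈ ξ.carrier then conj s ξ h else ξ)
    (fun s => TopologicalSpace.isOpen_generateFrom_of_mem ⟨star s * s, Or.inl rfl⟩)
    (fun s => by
      have hO : IsOpen {ξ : TightFilter S | star s * s ∈ ξ.carrier} :=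
        TopologicalSpace.isOpen_generateFrom_of_mem ⟨star s * s, Or.inl rfl⟩
      refine (continuousOn_to_generateFrom_iff).2 ?_
      rintro ξ (hξ : star s * s ∈ ξ.carrier) t ⟨e, rfl | rfl⟩ he
      · simp only [Set.mem_ofPred_eq, dif_pos hξ] at he
        have h1 : IsOpen {η : TightFilter S | star s * e * s ∈ η.carrier} :=
          TopologicalSpace.isOpen_generateFrom_of_mem ⟨_, Or.inl rfl⟩
        refine mem_nhdsWithin.2 ⟨_, h1, he.2, ?_⟩
        rintro η ⟨h2, (h3 : star s * s ∈ η.carrier)⟩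
        simp only [Set.mem_preimage, Set.mem_ofPred_eq, dif_pos h3]
        exact ⟨he.1, h2⟩
      · simp only [Set.mem_ofPred_eq, dif_pos hξ] at he
        by_cases hi : IsIdempotentElem e
        · have h1 : IsOpen {η : TightFilter S | star s * e * s ∉ η.carrier} :=
            TopologicalSpace.isOpen_generateFrom_of_mem ⟨_, Or.inr rfl⟩
          refine mem_nhdsWithin.2 ⟨_, h1, fun h => he ⟨hi, h⟩, ?_⟩
          rintro η ⟨h2, (h3 : star s * s ∈ η.carrier)⟩
          simp only [Set.mem_preimage, Set.mem_ofPred_eq, dif_pos h3]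
          exact fun h => h2 h.2
        · refine mem_nhdsWithin.2 ⟨_, isOpen_univ, trivial, ?_⟩
          rintro η ⟨-, (h3 : star s * s ∈ η.carrier)⟩
          simp only [Set.mem_preimage, Set.mem_ofPred_eq, dif_pos h3]
          exact fun h => hi h.1)
    (fun s ξ (h : star s * s ∈ ξ.carrier) => by
      have h1 : star (star s) * star s ∈ (conj s ξ h).carrier := by
        rw [star_star']
        exact ⟨idem_mul_star s, by rwa [← mul_assoc, star_regular]⟩
      simp only [dif_pos h, Set.mem_ofPred_eq, dif_pos h1]
      refine ⟨h1, ext' ?_⟩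
      have hss : ∀ f : S, IsIdempotentElem f → star s * (s * f * star s) * s =
          star s * s * f := by
        intro f hf
        calc star s * (s * f * star s) * s = star s * s * (f * (star s * s)) := by
              simp only [mul_assoc]
          _ = (star s * s * star s) * s * f := by
              rw [idem_comm _ _ hf (idem_star_mul s)]; simp only [mul_assoc]
          _ = star s * s * f := by rw [star_regular]
      ext f
      constructor
      · rintro ⟨hf, -, hf'⟩
        rw [star_star', hss f hf] at hf'
        refine ξ.mem_of_le _ hf' f hf ?_
        rw [mul_assoc, hf.eq]
      · intro hf
        have hi := ξ.idem f hf
        refine ⟨hi, idem_conj (star s) hi, ?_⟩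
        rw [star_star', hss f hi]
        exact ξ.mul_mem _ h _ hf)
    (fun s t ξ => by
      have e : star (s * t) * (s * t) = star t * (star s * s) * t := by
        rw [star_mul_rev]; simp only [mul_assoc]
      simp only [Set.mem_ofPred_eq]
      rw [e]
      constructor
      · intro h
        have ht : star t * t ∈ ξ.carrier := by
          refine ξ.mem_of_le _ h _ (idem_star_mul t) ?_
          calc star t * (star s * s) * t * (star t * t)
              = star t * (star s * s) * (t * star t * t) := by simp only [mul_assoc]
            _ = star t * (star s * s) * t := by rw [regular]
        refine ⟨ht, ?_⟩
        rw [dif_pos ht]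
        exact ⟨idem_star_mul s, h⟩
      · rintro ⟨ht, h⟩
        rw [dif_pos ht] at h
        exact h.2)
    (fun s t ξ (ht : star t * t ∈ ξ.carrier) h => by
      rw [dif_pos ht] at h ⊢
      have h' : star s * s ∈ (conj t ξ ht).carrier := h
      have hst : star (s * t) * (s * t) ∈ ξ.carrier := by
        have := h'.2
        rw [star_mul_rev]
        simpa only [mul_assoc] using this
      rw [dif_pos h', dif_pos hst]
      refine ext' ?_
      ext f
      have e : star (s * t) * f * (s * t) = star t * (star s * f * s) * t := by
        rw [star_mul_rev]; simp only [mul_assoc]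
      constructor
      · rintro ⟨hf, hf'⟩
        rw [e] at hf'
        exact ⟨hf, idem_conj s hf, hf'⟩
      · rintro ⟨hf, -, hf'⟩
        refine ⟨hf, ?_⟩
        rwa [e])
    (by
      refine Set.eq_empty_iff_forall_notMem.2 fun ξ (h : star 0 * 0 ∈ ξ.carrier) => ?_
      rw [mul_zero] at h
      exact ξ.zero_notMem h)
    (fun ξ => by
      obtain ⟨e, he⟩ := ξ.nonempty
      refine ⟨e, ?_⟩
      change star e * e ∈ ξ.carrier
      rw [star_idem (ξ.idem e he), (ξ.idem e he).eq]
      exact he)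

end TightFilter

/-- The tight groupoid of `S`: the groupoid of germs of the standard action of `S` on the space of
tight filters. -/
noncomputable def tightGroupoid (S : Type*) [InverseSemigroup S] :
    EtaleGroupoid (TightFilter S) (TightFilter.action S).Germ :=
  (TightFilter.action S).germGroupoid

end InverseSemigroup

/-- A self-similar graph `(G, E, φ)`: a directed graph with vertices `E0`, edges `E1`, range `r` and
source `s`, on which the group `G` acts by graph automorphisms, and a one-cocycle
`φ : G × E1 → G` with `φ(g, a) • s(a) = g • s(a)`. -/
structure SelfSimilarGraph (G E0 E1 : Type*) [Group G] [MulAction G E0] [MulAction G E1] where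
  r : E1 → E0
  s : E1 → E0
  r_smul : ∀ (g : G) (a : E1), r (g • a) = g • r a
  s_smul : ∀ (g : G) (a : E1), s (g • a) = g • s a
  φ : G → E1 → G
  φ_mul : ∀ (g h : G) (a : E1), φ (g * h) a = φ g (h • a) * φ h a
  φ_smul_s : ∀ (g : G) (a : E1), φ g a • s a = g • s a

namespace SelfSimilarGraph

variable {G E0 E1 : Type*} [Group G] [MulAction G E0] [MulAction G E1]
  (T : SelfSimilarGraph G E0 E1)

/-- The edges `a₁ a₂ … aₙ` form a path with range `x`: `r(a₁) = x` and `s(aᵢ) = r(aᵢ₊₁)`. -/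
def IsPath : E0 → List E1 → Prop
  | _, [] => True
  | x, a :: l => T.r a = x ∧ IsPath (T.s a) l

/-- The source of the path with range `x` and the given edges. -/
def endpoint : E0 → List E1 → E0
  | x, [] => x
  | _, a :: l => endpoint (T.s a) l

/-- The extension of the action to finite paths, `g(aα) = (ga)(φ(g, a)α)`. -/
def pathAct : G → List E1 → List E1
  | _, [] => []
  | g, a :: l => (g • a) :: pathAct (T.φ g a) l

/-- The extension of the cocycle to finite paths, `φ(g, aα) = φ(φ(g, a), α)`. -/
def pathφ : G → List E1 → G
  | g, [] => g
  | g, a :: l => pathφ (T.φ g a) l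

/-- The prolongation of the action to infinite sequences of edges,
`g(aω) = (ga)(φ(g, a)ω)`. -/
def seqAct : G → (ℕ → E1) → ℕ → E1
  | g, ω, 0 => g • ω 0
  | g, ω, n + 1 => seqAct (T.φ g (ω 0)) (fun k => ω (k + 1)) n

/-- Finite paths, including the vertices as the paths of length zero. -/
@[ext] structure FinPath where
  rng : E0
  edges : List E1
  isPath : T.IsPath rng edges

/-- The source `s(α)` of a finite path. -/
def FinPath.src {T : SelfSimilarGraph G E0 E1} (α : T.FinPath) : E0 := T.endpoint α.rng α.edges

section Lemmas

lemma φ_one (a : E1) : T.φ 1 a = 1 := by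
  have h := T.φ_mul 1 1 a
  rw [one_mul, one_smul] at h
  exact left_eq_mul.1 h

lemma isPath_append (x : E0) (l m : List E1) :
    T.IsPath x (l ++ m) ↔ T.IsPath x l ∧ T.IsPath (T.endpoint x l) m := by
  induction l generalizing x with
  | nil => simp [IsPath, endpoint]
  | cons a l ih => simp [IsPath, endpoint, ih, and_assoc]

lemma endpoint_append (x : E0) (l m : List E1) :
    T.endpoint x (l ++ m) = T.endpoint (T.endpoint x l) m := by
  induction l generalizing x with
  | nil => rfl
  | cons a l ih => exact ih _

lemma isPath_pathAct (g : G) (x : E0) (l : List E1) (h : T.IsPath x l) :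
    T.IsPath (g • x) (T.pathAct g l) := by
  induction l generalizing g x with
  | nil => trivial
  | cons a l ih =>
    refine ⟨by rw [T.r_smul, h.1], ?_⟩
    rw [T.s_smul, ← T.φ_smul_s]
    exact ih _ _ h.2

lemma endpoint_pathAct (g : G) (x : E0) (l : List E1) :
    T.endpoint (g • x) (T.pathAct g l) = T.pathφ g l • T.endpoint x l := by
  induction l generalizing g x with
  | nil => rfl
  | cons a l ih =>
    simp only [endpoint, pathAct, pathφ]
    rw [T.s_smul, ← T.φ_smul_s]
    exact ih _ _

lemma pathAct_append (g : G) (l m : List E1) :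
    T.pathAct g (l ++ m) = T.pathAct g l ++ T.pathAct (T.pathφ g l) m := by
  induction l generalizing g with
  | nil => rfl
  | cons a l ih => simp [pathAct, pathφ, ih]

lemma pathφ_append (g : G) (l m : List E1) :
    T.pathφ g (l ++ m) = T.pathφ (T.pathφ g l) m := by
  induction l generalizing g with
  | nil => rfl
  | cons a l ih => simp [pathφ, ih]

lemma length_pathAct (g : G) (l : List E1) : (T.pathAct g l).length = l.length := by
  induction l generalizing g with
  | nil => rfl
  | cons a l ih => simp [pathAct, ih]

lemma pathAct_mul (g h : G) (l : List E1) :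
    T.pathAct (g * h) l = T.pathAct g (T.pathAct h l) := by
  induction l generalizing g h with
  | nil => rfl
  | cons a l ih => simp only [pathAct, mul_smul, T.φ_mul, ih]

lemma pathφ_mul (g h : G) (l : List E1) :
    T.pathφ (g * h) l = T.pathφ g (T.pathAct h l) * T.pathφ h l := by
  induction l generalizing g h with
  | nil => rfl
  | cons a l ih => simp only [pathAct, pathφ, T.φ_mul, ih]

lemma pathAct_one (l : List E1) : T.pathAct 1 l = l := by
  induction l with
  | nil => rfl
  | cons a l ih => simp [pathAct, T.φ_one, ih]

lemma pathφ_one (l : List E1) : T.pathφ 1 l = 1 := by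
  induction l with
  | nil => rfl
  | cons a l ih => simp [pathφ, T.φ_one, ih]

lemma pathAct_inv (h : G) (l : List E1) : T.pathAct h (T.pathAct h⁻¹ l) = l := by
  rw [← T.pathAct_mul, mul_inv_cancel, T.pathAct_one]

lemma pathAct_inv' (h : G) (l : List E1) : T.pathAct h⁻¹ (T.pathAct h l) = l := by
  rw [← T.pathAct_mul, inv_mul_cancel, T.pathAct_one]

lemma pathφ_inv (h : G) (l : List E1) : T.pathφ h (T.pathAct h⁻¹ l) = (T.pathφ h⁻¹ l)⁻¹ := by
  have := T.pathφ_mul h h⁻¹ l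
  rw [mul_inv_cancel, T.pathφ_one] at this
  exact eq_inv_of_mul_eq_one_left this.symm

end Lemmas

/-- The concatenation `αε` of a finite path with further edges. -/
def FinPath.append {T : SelfSimilarGraph G E0 E1} (α : T.FinPath) (l : List E1)
    (h : T.IsPath α.src l) : T.FinPath :=
  ⟨α.rng, α.edges ++ l, (T.isPath_append _ _ _).2 ⟨α.isPath, h⟩⟩

lemma FinPath.src_append {T : SelfSimilarGraph G E0 E1} (α : T.FinPath) (l : List E1)
    (h : T.IsPath α.src l) : (α.append l h).src = T.endpoint α.src l :=
  T.endpoint_append _ _ _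

/-- `α` is an initial segment of `β`, i.e. `β = αε` for some path `ε` (whose edges are then
`β.edges.drop α.edges.length`). -/
def FinPath.IsPrefix {T : SelfSimilarGraph G E0 E1} (α β : T.FinPath) : Prop :=
  α.rng = β.rng ∧ α.edges <+: β.edges

/-- The edges of `ε` when `β = αε`. -/
def FinPath.rest {T : SelfSimilarGraph G E0 E1} (α β : T.FinPath) : List E1 :=
  β.edges.drop α.edges.length

lemma FinPath.IsPrefix.eq {T : SelfSimilarGraph G E0 E1} {α β : T.FinPath} (h : α.IsPrefix β) :
    β.edges = α.edges ++ α.rest β := by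
  obtain ⟨m, hm⟩ := h.2
  rw [rest, ← hm, List.drop_left]

lemma FinPath.IsPrefix.isPath {T : SelfSimilarGraph G E0 E1} {α β : T.FinPath}
    (h : α.IsPrefix β) : T.IsPath α.src (α.rest β) := by
  have hb := β.isPath
  rw [h.eq, ← h.1] at hb
  exact ((T.isPath_append _ _ _).1 hb).2

lemma FinPath.IsPrefix.src_eq {T : SelfSimilarGraph G E0 E1} {α β : T.FinPath}
    (h : α.IsPrefix β) : β.src = T.endpoint α.src (α.rest β) := by
  unfold FinPath.src
  rw [h.eq, T.endpoint_append, h.1]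

/-- The underlying set of the inverse semigroup `S_{G,E}`: the triples `(α, g, β)` with
`s(α) = g s(β)`, and a zero. -/
inductive SGE where
  | zero : SGE
  | triple (α : T.FinPath) (g : G) (β : T.FinPath) (h : α.src = g • β.src) : SGE

namespace SGE

variable {T}

lemma isPath_left {γ β δ : T.FinPath} {h : G} (hp : γ.IsPrefix β) (e₂ : γ.src = h • δ.src) :
    T.IsPath δ.src (T.pathAct h⁻¹ (γ.rest β)) := by
  have := T.isPath_pathAct h⁻¹ _ _ hp.isPath
  rwa [e₂, inv_smul_smul] at this

lemma src_left {α γ β δ : T.FinPath} {g h : G} (e₁ : α.src = g • β.src) (hp : γ.IsPrefix β)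
    (e₂ : γ.src = h • δ.src) :
    α.src = (g * (T.pathφ h⁻¹ (γ.rest β))⁻¹) •
      (δ.append (T.pathAct h⁻¹ (γ.rest β)) (isPath_left hp e₂)).src := by
  have h1 := T.endpoint_pathAct h⁻¹ γ.src (γ.rest β)
  have h2 : h⁻¹ • γ.src = δ.src := by rw [e₂, inv_smul_smul]
  rw [h2] at h1
  rw [e₁, hp.src_eq, FinPath.src_append, h1, mul_smul, inv_smul_smul]

lemma isPath_right {α γ β : T.FinPath} {g : G} (e₁ : α.src = g • β.src) (hq : β.IsPrefix γ) :
    T.IsPath α.src (T.pathAct g (β.rest γ)) := by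
  rw [e₁]
  exact T.isPath_pathAct g _ _ hq.isPath

lemma src_right {α γ β δ : T.FinPath} {g h : G} (e₁ : α.src = g • β.src) (hq : β.IsPrefix γ)
    (e₂ : γ.src = h • δ.src) :
    (α.append (T.pathAct g (β.rest γ)) (isPath_right e₁ hq)).src =
      (T.pathφ g (β.rest γ) * h) • δ.src := by
  rw [FinPath.src_append, e₁, T.endpoint_pathAct, ← hq.src_eq, e₂, mul_smul]

open Classical in
/-- `(α, g, β)(γ, h, δ)` equals `(α, g φ(h⁻¹, ε)⁻¹, δ (h⁻¹ε))` if `β = γε`, equals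
`(α (gε), φ(g, ε) h, δ)` if `γ = βε`, and is zero otherwise. -/
noncomputable def mul : T.SGE → T.SGE → T.SGE
  | zero, _ => zero
  | triple _ _ _ _, zero => zero
  | triple α g β e₁, triple γ h δ e₂ =>
    if hp : γ.IsPrefix β then
      triple α (g * (T.pathφ h⁻¹ (γ.rest β))⁻¹)
        (δ.append (T.pathAct h⁻¹ (γ.rest β)) (isPath_left hp e₂)) (src_left e₁ hp e₂)
    else if hq : β.IsPrefix γ then
      triple (α.append (T.pathAct g (β.rest γ)) (isPath_right e₁ hq))
        (T.pathφ g (β.rest γ) * h) δ (src_right e₁ hq e₂)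
    else zero

noncomputable instance : Mul T.SGE := ⟨mul⟩

instance : Zero T.SGE := ⟨zero⟩

/-- `(α, g, β)* = (β, g⁻¹, α)`. -/
instance : Star T.SGE where
  star
    | zero => zero
    | triple α g β h => triple β g⁻¹ α (by rw [h, inv_smul_smul])

lemma zero_def : (0 : T.SGE) = zero := rfl

lemma star_triple (α : T.FinPath) (g : G) (β : T.FinPath) (h : α.src = g • β.src) :
    star (triple α g β h) = triple β g⁻¹ α (by rw [h, inv_smul_smul]) := rfl

lemma triple_congr {α α' β β' : T.FinPath} {g g' : G} {h h'} (e₁ : α = α') (e₂ : g = g')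
    (e₃ : β = β') : triple α g β h = triple α' g' β' h' := by
  subst e₁ e₂ e₃; rfl

open Classical in
/-- A faithful representation of `S_{G,E}` by partial maps, used to check associativity. -/
noncomputable def rep : T.SGE → E0 × List E1 × G → Option (E0 × List E1 × G)
  | zero, _ => none
  | triple α g β _, p =>
    if p.1 = β.rng ∧ β.edges <+: p.2.1 then
      some (α.rng, α.edges ++ T.pathAct g (p.2.1.drop β.edges.length),
        T.pathφ g (p.2.1.drop β.edges.length) * p.2.2)
    else none

lemma rep_some {α : T.FinPath} {g : G} {β : T.FinPath} {h} (l : List E1) (k : G) :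
    rep (triple α g β h) (β.rng, β.edges ++ l, k) =
      some (α.rng, α.edges ++ T.pathAct g l, T.pathφ g l * k) := by
  rw [rep, if_pos ⟨rfl, List.prefix_append _ _⟩]
  simp

lemma rep_none {α : T.FinPath} {g : G} {β : T.FinPath} {h} {p : E0 × List E1 × G}
    (hp : ¬ (p.1 = β.rng ∧ β.edges <+: p.2.1)) : rep (triple α g β h) p = none := by
  rw [rep, if_neg hp]

lemma rep_injective {x y : T.SGE} (h : ∀ p, rep x p = rep y p) : x = y := by
  have aux : ∀ (α : T.FinPath) (g : G) (β : T.FinPath) (e : α.src = g • β.src) (y : T.SGE),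
      rep (triple α g β e) (β.rng, β.edges, 1) = rep y (β.rng, β.edges, 1) →
      ∃ α' g' β' e', y = triple α' g' β' e' ∧ β'.rng = β.rng ∧ β'.edges <+: β.edges := by
    intro α g β e y hy
    have h1 := rep_some (h := e) [] (1 : G)
    rw [List.append_nil] at h1
    rw [h1] at hy
    cases y with
    | zero => simp [rep] at hy
    | triple α' g' β' e' =>
      refine ⟨α', g', β', e', rfl, ?_⟩
      by_contra hc
      rw [rep_none] at hy
      · simp at hy
      · rintro ⟨a, b⟩
        exact hc ⟨a.symm, b⟩
  cases x with
  | zero =>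
    cases y with
    | zero => rfl
    | triple α' g' β' e' =>
      obtain ⟨_, _, _, _, h1, -⟩ := aux α' g' β' e' zero (h _).symm
      cases h1
  | triple α g β e =>
    obtain ⟨α', g', β', e', rfl, h2, h3⟩ := aux α g β e y (h _)
    obtain ⟨_, _, _, _, h4, h5, h6⟩ := aux α' g' β' e' _ (h _).symm
    cases h4
    have hb : β = β' := FinPath.ext h2.symm
      (h6.eq_of_length (le_antisymm h6.length_le h3.length_le))
    subst hb
    have h1 := rep_some (h := e) [] (1 : G)
    have h1' := rep_some (h := e') [] (1 : G)
    rw [h, h1'] at h1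
    simp only [pathAct, pathφ, List.append_nil, mul_one, Option.some.injEq, Prod.mk.injEq] at h1
    exact triple_congr (FinPath.ext h1.1.symm h1.2.1.symm) h1.2.2.symm rfl

lemma mul_def (x y : T.SGE) : x * y = mul x y := rfl

lemma rep_mul (x y : T.SGE) (p : E0 × List E1 × G) :
    rep (x * y) p = (rep y p).bind (rep x) := by
  rw [mul_def]
  cases x with
  | zero => cases h : rep y p <;> simp [mul, rep]
  | triple α g β e₁ =>
  cases y with
  | zero => simp [mul, rep]
  | triple γ h δ e₂ =>
  obtain ⟨v, l, k⟩ := p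
  by_cases hy : v = δ.rng ∧ δ.edges <+: l
  · obtain ⟨rfl, m, rfl⟩ := hy
    rw [rep_some, Option.bind_some]
    rw [mul]
    split_ifs with hp hq
    · have hβ := hp.eq
      by_cases hm : T.pathAct h⁻¹ (γ.rest β) <+: m
      · obtain ⟨n, rfl⟩ := hm
        have := rep_some (α := α) (g := g * (T.pathφ h⁻¹ (γ.rest β))⁻¹)
          (β := δ.append (T.pathAct h⁻¹ (γ.rest β)) (isPath_left hp e₂))
          (h := src_left e₁ hp e₂) n k
        rw [← List.append_assoc δ.edges]
        refine Eq.trans this ?_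
        rw [T.pathAct_append, T.pathAct_inv, ← List.append_assoc, ← hβ, hp.1, rep_some,
          T.pathφ_append, T.pathφ_inv, T.pathAct_mul, T.pathφ_mul]
        simp only [mul_assoc]
      · rw [rep_none, rep_none]
        · rintro ⟨-, h2⟩
          simp only at h2
          rw [hβ, List.prefix_append_right_inj] at h2
          obtain ⟨n, hn⟩ := h2
          apply hm
          rw [← T.pathAct_inv' h m, ← hn, T.pathAct_append]
          exact List.prefix_append _ _
        · rintro ⟨-, h2⟩
          simp only [FinPath.append] at h2
          rw [List.prefix_append_right_inj] at h2
          exact hm h2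
    · have hγ := hq.eq
      rw [rep_some, hγ, ← hq.1, List.append_assoc, rep_some]
      simp only [FinPath.append, T.pathAct_append, T.pathφ_append, T.pathAct_mul, T.pathφ_mul,
        List.append_assoc, mul_assoc]
    · rw [rep_none]
      · rfl
      · rintro ⟨h1, h2⟩
        simp only at h1 h2
        rcases List.prefix_or_prefix_of_prefix h2 (List.prefix_append γ.edges _) with h3 | h3
        · exact hq ⟨h1.symm, h3⟩
        · exact hp ⟨h1, h3⟩
  · rw [rep_none (h := e₂) hy, Option.bind_none]
    rw [mul]
    split_ifs with hp hq
    · refine rep_none ?_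
      rintro ⟨h1, h2⟩
      exact hy ⟨h1, (List.prefix_append _ _).trans h2⟩
    · exact rep_none hy
    · rfl

lemma isPrefix_refl (α : T.FinPath) : α.IsPrefix α := ⟨rfl, List.prefix_refl _⟩

lemma triple_mul_triple_self (α : T.FinPath) (g : G) (β : T.FinPath) (e) (h : G)
    (δ : T.FinPath) (e') :
    triple α g β e * triple β h δ e' = triple α (g * h) δ (by rw [e, e', smul_smul]) := by
  rw [mul_def]
  rw [mul]
  rw [dif_pos (isPrefix_refl β)]
  have h0 : β.rest β = [] := by simp [FinPath.rest]
  refine triple_congr rfl ?_ ?_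
  · rw [h0]; simp [pathφ]
  · simp only [h0, pathAct, FinPath.append]
    exact FinPath.ext rfl (List.append_nil _)

lemma idem_eq (x : T.SGE) (hx : IsIdempotentElem x) :
    x = 0 ∨ ∃ α : T.FinPath, x = triple α 1 α (one_smul _ _).symm := by
  cases x with
  | zero => exact Or.inl rfl
  | triple α g β e =>
    right
    have h1 : mul (triple α g β e) (triple α g β e) = triple α g β e := hx
    rw [mul] at h1
    split_ifs at h1 with hp hq
    · injection h1 with a b c
      have hl := congrArg (fun γ : T.FinPath => γ.edges.length) c
      simp only [FinPath.append, List.length_append, T.length_pathAct] at hl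
      have h0 : α.rest β = [] := List.length_eq_zero_iff.1 (by omega)
      have hab : α = β := FinPath.ext hp.1 (by rw [hp.eq, h0, List.append_nil])
      subst hab
      rw [h0] at b
      simp only [pathφ, inv_inv] at b
      exact ⟨α, triple_congr rfl (mul_eq_left.1 b) rfl⟩
    · injection h1 with a b c
      have hl := congrArg (fun γ : T.FinPath => γ.edges.length) a
      simp only [FinPath.append, List.length_append, T.length_pathAct] at hl
      have h0 : β.rest α = [] := List.length_eq_zero_iff.1 (by omega)
      have hab : β = α := FinPath.ext hq.1 (by rw [hq.eq, h0, List.append_nil])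
      subst hab
      rw [h0] at b
      simp only [pathφ] at b
      exact ⟨β, triple_congr rfl (mul_eq_left.1 b) rfl⟩

lemma rep_idem (α : T.FinPath) (p : E0 × List E1 × G) :
    rep (triple α 1 α (one_smul _ _).symm) p = none ∨
      rep (triple α 1 α (one_smul _ _).symm) p = some p := by
  obtain ⟨v, l, k⟩ := p
  by_cases h : v = α.rng ∧ α.edges <+: l
  · obtain ⟨rfl, m, rfl⟩ := h
    right
    rw [rep_some, T.pathAct_one, T.pathφ_one, one_mul]
  · exact Or.inl (rep_none h)

/-- `S_{G,E}` is an inverse semigroup with zero. -/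
noncomputable instance : InverseSemigroup T.SGE where
  mul_assoc x y z := rep_injective fun p => by
    simp only [rep_mul]
    cases rep z p <;> simp
  zero_mul x := by
    rw [zero_def, mul_def]
    rfl
  mul_zero x := by
    rw [zero_def, mul_def]
    cases x <;> rfl
  regular x := by
    cases x with
    | zero => rfl
    | triple α g β e =>
      rw [star_triple, triple_mul_triple_self, triple_mul_triple_self]
      exact triple_congr rfl (by simp) rfl
  star_regular x := by
    cases x with
    | zero => rfl
    | triple α g β e =>
      rw [star_triple, triple_mul_triple_self, triple_mul_triple_self]
      exact triple_congr rfl (by simp) rfl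
  idem_comm x y hx hy := by
    have h0 : ∀ z : T.SGE, (0 : T.SGE) * z = 0 := fun z => rfl
    have h0' : ∀ z : T.SGE, z * (0 : T.SGE) = 0 := fun z => by cases z <;> rfl
    rcases idem_eq x hx with rfl | ⟨α, rfl⟩
    · rw [h0, h0']
    · rcases idem_eq y hy with rfl | ⟨β, rfl⟩
      · rw [h0, h0']
      · refine rep_injective fun p => ?_
        rw [rep_mul, rep_mul]
        rcases rep_idem α p with ha | ha <;> rcases rep_idem β p with hb | hb <;>
          simp [ha, hb]

end SGE

/-- The sequence `a₁ … aₙ ω₀ ω₁ …`. -/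
def conc : List E1 → (ℕ → E1) → ℕ → E1
  | [], ω, n => ω n
  | a :: _, _, 0 => a
  | _ :: l, ω, n + 1 => conc l ω n

/-- The space `E^∞` of one-sided infinite paths `ω₀ ω₁ …`, with `s(ωₙ) = r(ωₙ₊₁)`. -/
@[ext] structure InfPath where
  edges : ℕ → E1
  isPath : ∀ n, T.s (edges n) = T.r (edges (n + 1))

/-- The range of an infinite path. -/
def InfPath.rng {T : SelfSimilarGraph G E0 E1} (ω : T.InfPath) : E0 := T.r (ω.edges 0)

section Lemmas

lemma seqAct_mul (g h : G) (ω : ℕ → E1) : T.seqAct (g * h) ω = T.seqAct g (T.seqAct h ω) := by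
  funext n
  induction n generalizing g h ω with
  | zero => simp only [seqAct, mul_smul]
  | succ n ih =>
    have := ih (T.φ g (h • ω 0)) (T.φ h (ω 0)) (fun k => ω (k + 1))
    rw [← T.φ_mul] at this
    exact this

lemma seqAct_one (ω : ℕ → E1) : T.seqAct 1 ω = ω := by
  funext n
  induction n generalizing ω with
  | zero => simp [seqAct]
  | succ n ih =>
    simp only [seqAct, T.φ_one]
    exact ih _

lemma seqAct_inv (g : G) (ω : ℕ → E1) : T.seqAct g (T.seqAct g⁻¹ ω) = ω := by
  rw [← T.seqAct_mul, mul_inv_cancel, T.seqAct_one]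

lemma seqAct_inv' (g : G) (ω : ℕ → E1) : T.seqAct g⁻¹ (T.seqAct g ω) = ω := by
  rw [← T.seqAct_mul, inv_mul_cancel, T.seqAct_one]

lemma seqAct_conc (g : G) (l : List E1) (ω : ℕ → E1) :
    T.seqAct g (conc l ω) = conc (T.pathAct g l) (T.seqAct (T.pathφ g l) ω) := by
  induction l generalizing g with
  | nil => rfl
  | cons a l ih =>
    funext n
    cases n with
    | zero => rfl
    | succ n => exact congrFun (ih (T.φ g a)) n

lemma conc_append (l m : List E1) (ω : ℕ → E1) : conc (l ++ m) ω = conc l (conc m ω) := by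
  induction l with
  | nil => rfl
  | cons a l ih =>
    funext n
    cases n with
    | zero => rfl
    | succ n => exact congrFun ih n

lemma conc_add (l : List E1) (ω : ℕ → E1) (n : ℕ) : conc l ω (n + l.length) = ω n := by
  induction l with
  | nil => rfl
  | cons a l ih => exact ih

lemma conc_injective (l : List E1) {ω η : ℕ → E1} (h : conc l ω = conc l η) : ω = η := by
  funext n
  rw [← conc_add l ω n, h, conc_add]

lemma prefix_of_conc_eq (l m : List E1) (ω η : ℕ → E1) (h : conc l ω = conc m η) :
    l <+: m ∨ m <+: l := by
  induction l generalizing m with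
  | nil => exact Or.inl (List.nil_prefix)
  | cons a l ih =>
    cases m with
    | nil => exact Or.inr (List.nil_prefix)
    | cons b m =>
      have h0 : a = b := congrFun h 0
      have h1 : conc l ω = conc m η := funext fun n => congrFun h (n + 1)
      subst h0
      simpa using ih m h1

lemma seqAct_congr (g : G) {N : ℕ} {ω η : ℕ → E1} (h : ∀ i < N, ω i = η i) :
    ∀ i < N, T.seqAct g ω i = T.seqAct g η i := by
  intro i
  induction i generalizing g N ω η with
  | zero => intro hi; simp only [seqAct, h 0 hi]
  | succ n ih =>
    intro hi
    simp only [seqAct, h 0 (by omega)]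
    exact ih _ (N := N - 1) (fun i hi => h _ (by omega)) (by omega)

lemma conc_congr (l : List E1) {N : ℕ} {ω η : ℕ → E1} (h : ∀ i < N, ω i = η i) :
    ∀ i < N, conc l ω i = conc l η i := by
  induction l generalizing N with
  | nil => exact h
  | cons a l ih =>
    intro i hi
    cases i with
    | zero => rfl
    | succ n => exact ih h n (by omega)

lemma conc_drop (l : List E1) {ω η : ℕ → E1} (h : ∀ i < l.length, ω i = conc l η i) :
    ω = conc l (fun n => ω (n + l.length)) := by
  induction l generalizing ω with
  | nil => rfl
  | cons a l ih =>
    funext n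
    cases n with
    | zero => exact h 0 (by simp)
    | succ n =>
      exact congrFun (ih (ω := fun k => ω (k + 1)) fun i hi => h (i + 1) (by simpa using hi)) n

lemma seqAct_isPath (g : G) (ω : ℕ → E1) (h : ∀ n, T.s (ω n) = T.r (ω (n + 1))) (n : ℕ) :
    T.s (T.seqAct g ω n) = T.r (T.seqAct g ω (n + 1)) := by
  induction n generalizing g ω with
  | zero =>
    simp only [seqAct]
    rw [T.s_smul, T.r_smul, ← T.φ_smul_s, h]
  | succ n ih => exact ih _ _ fun k => h (k + 1)

lemma conc_isPath (x : E0) (l : List E1) (ω : ℕ → E1) (hl : T.IsPath x l)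
    (h : T.endpoint x l = T.r (ω 0)) (hω : ∀ n, T.s (ω n) = T.r (ω (n + 1))) :
    T.r (conc l ω 0) = x ∧ ∀ n, T.s (conc l ω n) = T.r (conc l ω (n + 1)) := by
  induction l generalizing x with
  | nil => exact ⟨h.symm, hω⟩
  | cons a l ih =>
    obtain ⟨h1, h2⟩ := ih (T.s a) hl.2 h
    refine ⟨hl.1, fun n => ?_⟩
    cases n with
    | zero => exact h1.symm
    | succ n => exact h2 n

lemma endpoint_eq_of_conc (x : E0) (l : List E1) (ω : ℕ → E1) (h : T.r (conc l ω 0) = x)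
    (hω : ∀ n, T.s (conc l ω n) = T.r (conc l ω (n + 1))) :
    T.IsPath x l ∧ T.endpoint x l = T.r (ω 0) := by
  induction l generalizing x with
  | nil => exact ⟨trivial, h.symm⟩
  | cons a l ih =>
    obtain ⟨h1, h2⟩ := ih (T.s a) (hω 0).symm fun n => hω (n + 1)
    exact ⟨⟨h, h1⟩, h2⟩

end Lemmas

namespace InfPath

variable {T}

/-- The action of `G` on infinite paths. -/
def smul (g : G) (ω : T.InfPath) : T.InfPath :=
  ⟨T.seqAct g ω.edges, T.seqAct_isPath g _ ω.isPath⟩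

/-- The infinite path with the first `n` edges removed. -/
def drop (n : ℕ) (ω : T.InfPath) : T.InfPath :=
  ⟨fun k => ω.edges (k + n), fun k => by
    have := ω.isPath (k + n)
    rwa [add_right_comm] at this⟩

lemma rng_smul (g : G) (ω : T.InfPath) : (smul g ω).rng = g • ω.rng := T.r_smul g _

end InfPath

variable {T} in
/-- The infinite path `αω`, defined when `s(α) = r(ω)`. -/
def FinPath.concat (α : T.FinPath) (ω : T.InfPath) (h : α.src = ω.rng) : T.InfPath :=
  ⟨conc α.edges ω.edges, (T.conc_isPath α.rng _ _ α.isPath h ω.isPath).2⟩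

variable {T} in
/-- The cylinder `Z(α) = {αω : ω ∈ E^∞, r(ω) = s(α)}`. -/
def FinPath.cylinder (α : T.FinPath) : Set T.InfPath :=
  {ω | ∃ (η : T.InfPath) (h : α.src = η.rng), ω = α.concat η h}

/-- The topology on `E^∞` generated by the cylinders. -/
instance : TopologicalSpace T.InfPath :=
  TopologicalSpace.generateFrom {U | ∃ α : T.FinPath, U = α.cylinder}

namespace InfPath

variable {T}

lemma rng_concat (α : T.FinPath) (ω : T.InfPath) (h : α.src = ω.rng) :
    (α.concat ω h).rng = α.rng :=
  (T.conc_isPath α.rng _ _ α.isPath h ω.isPath).1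

lemma mem_cylinder {α : T.FinPath} {ω : T.InfPath} :
    ω ∈ α.cylinder ↔ ω.rng = α.rng ∧ ∃ η : ℕ → E1, ω.edges = conc α.edges η := by
  constructor
  · rintro ⟨η, h, rfl⟩
    exact ⟨rng_concat α η h, η.edges, rfl⟩
  · rintro ⟨h, η, hη⟩
    have hd : (ω.drop α.edges.length).edges = η := by
      funext n
      change ω.edges (n + α.edges.length) = η n
      rw [hη, conc_add]
    have hp := ω.isPath
    have hr := h
    unfold rng at hr
    rw [hη] at hp hr
    have h1 := (T.endpoint_eq_of_conc α.rng α.edges η hr hp).2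
    refine ⟨ω.drop α.edges.length, ?_, ?_⟩
    · unfold rng
      rw [hd]
      exact h1
    · refine InfPath.ext ?_
      change ω.edges = conc α.edges (ω.drop α.edges.length).edges
      rw [hd, hη]

lemma src_eq_rng_drop {α : T.FinPath} {ω : T.InfPath} (h : ω ∈ α.cylinder) :
    α.src = (ω.drop α.edges.length).rng := by
  obtain ⟨η, hη, rfl⟩ := h
  rw [hη]
  unfold rng
  refine congrArg T.r ?_
  exact (conc_add α.edges η.edges 0).symm

lemma drop_edges {α : T.FinPath} {ω : T.InfPath} {η : ℕ → E1} (h : ω.edges = conc α.edges η) :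
    (ω.drop α.edges.length).edges = η := by
  funext n
  change ω.edges (n + α.edges.length) = η n
  rw [h, conc_add]

lemma isOpen_cylinder (α : T.FinPath) : IsOpen α.cylinder :=
  TopologicalSpace.isOpen_generateFrom_of_mem ⟨α, rfl⟩

lemma exists_initial (ω : T.InfPath) (N : ℕ) :
    ∃ α : T.FinPath, ω ∈ α.cylinder ∧ ∀ η ∈ α.cylinder, ∀ i < N, η.edges i = ω.edges i := by
  have hcd : ∀ (f : ℕ → E1) (N : ℕ), f = conc (List.ofFn fun i : Fin N => f i)
      (fun n => f (n + N)) := by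
    intro f N
    induction N generalizing f with
    | zero => rfl
    | succ N ih =>
      rw [List.ofFn_succ]
      funext n
      cases n with
      | zero => rfl
      | succ n =>
        refine (congrFun (ih (fun k => f (k + 1))) n).trans ?_
        simp only [conc, Fin.val_succ]
        have : (fun n => f (n + N + 1)) = fun n => f (n + (N + 1)) := rfl
        rw [this]
  have h := hcd ω.edges N
  have hp := ω.isPath
  rw [h] at hp
  have h1 := (T.endpoint_eq_of_conc ω.rng _ _ (by rw [← h]; rfl) hp).1
  refine ⟨⟨ω.rng, _, h1⟩, mem_cylinder.2 ⟨rfl, _, h⟩, fun η hη i hi => ?_⟩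
  obtain ⟨-, ζ, hζ⟩ := mem_cylinder.1 hη
  have aux : ∀ (l : List E1) (a b : ℕ → E1) (i : ℕ), i < l.length → conc l a i = conc l b i := by
    intro l
    induction l with
    | nil => intro a b i hi; simp at hi
    | cons c l ih =>
      intro a b i hi
      cases i with
      | zero => rfl
      | succ i => exact ih a b i (by simpa using hi)
  rw [hζ]
  exact (aux _ _ _ _ (by simpa using hi)).trans (congrFun h i).symm

end InfPath

/-- The domain of `(α, g, β)` on `E^∞`: the cylinder `Z(β)`; that of `0` is empty. -/
def SGE.dom {T : SelfSimilarGraph G E0 E1} : T.SGE → Set T.InfPath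
  | .zero => ∅
  | .triple _ _ β _ => β.cylinder

open Classical in
/-- The map `(α, g, β) · βη = α(gη)` on infinite paths (the identity off its domain). -/
noncomputable def SGE.act {T : SelfSimilarGraph G E0 E1} : T.SGE → T.InfPath → T.InfPath
  | .zero, ω => ω
  | .triple α g β e, ω =>
    if h : ω ∈ β.cylinder then
      α.concat ((ω.drop β.edges.length).smul g) (by
        rw [InfPath.rng_smul, ← InfPath.src_eq_rng_drop h, e])
    else ω

namespace SGE

variable {T}

lemma act_edges {α : T.FinPath} {g : G} {β : T.FinPath} {e} {ω : T.InfPath} {η : ℕ → E1}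
    (h : ω ∈ β.cylinder) (hη : ω.edges = conc β.edges η) :
    (act (triple α g β e) ω).edges = conc α.edges (T.seqAct g η) := by
  rw [act, dif_pos h]
  change conc α.edges (T.seqAct g (ω.drop β.edges.length).edges) = _
  rw [InfPath.drop_edges hη]

lemma act_rng {α : T.FinPath} {g : G} {β : T.FinPath} {e} {ω : T.InfPath}
    (h : ω ∈ β.cylinder) : (act (triple α g β e) ω).rng = α.rng := by
  rw [act, dif_pos h, InfPath.rng_concat]

lemma act_mem {α : T.FinPath} {g : G} {β : T.FinPath} {e} {ω : T.InfPath}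
    (h : ω ∈ β.cylinder) : act (triple α g β e) ω ∈ α.cylinder := by
  obtain ⟨-, η, hη⟩ := InfPath.mem_cylinder.1 h
  exact InfPath.mem_cylinder.2 ⟨act_rng h, _, act_edges h hη⟩

lemma continuousOn_act (x : T.SGE) : ContinuousOn (act x) (dom x) := by
  cases x with
  | zero => exact continuousOn_empty _
  | triple α g β e =>
    refine continuousOn_to_generateFrom_iff.2 ?_
    rintro ω hω t ⟨γ, rfl⟩ hγ
    obtain ⟨ζ, hωζ, hζ⟩ := ω.exists_initial (β.edges.length + γ.edges.length)
    refine mem_nhdsWithin.2 ⟨_, InfPath.isOpen_cylinder ζ, hωζ, ?_⟩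
    rintro ω' ⟨h1, h2⟩
    have hω' : ω' ∈ β.cylinder := h2
    obtain ⟨-, η, hη⟩ := InfPath.mem_cylinder.1 hω
    obtain ⟨-, η', hη'⟩ := InfPath.mem_cylinder.1 hω'
    obtain ⟨h3, θ, h4⟩ := InfPath.mem_cylinder.1 hγ
    refine InfPath.mem_cylinder.2 ⟨?_, _, conc_drop γ.edges (η := θ) fun i hi => ?_⟩
    · rw [act_rng hω', ← h3, act_rng hω]
    · rw [← h4, act_edges hω hη, act_edges hω' hη']
      refine conc_congr _ (T.seqAct_congr g (N := γ.edges.length) fun j hj => ?_) i hi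
      rw [← conc_add β.edges η' j, ← conc_add β.edges η j, ← hη, ← hη']
      exact hζ ω' h1 _ (by omega)

lemma mul_dom_act (x y : T.SGE) (ω : T.InfPath) :
    (ω ∈ dom (x * y) ↔ ω ∈ dom y ∧ act y ω ∈ dom x) ∧
      (ω ∈ dom (x * y) → act (x * y) ω = act x (act y ω)) := by
  rw [mul_def]
  cases x with
  | zero => simp [mul, dom]
  | triple α g β e₁ =>
  cases y with
  | zero => simp [mul, dom]
  | triple γ h δ e₂ =>
  by_cases hω : ω ∈ δ.cylinder
  · obtain ⟨hr, η, hη⟩ := InfPath.mem_cylinder.1 hω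
    have hy := act_edges (e := e₂) hω hη
    have hyr := act_rng (e := e₂) hω
    rw [mul]
    split_ifs with hp hq
    · have hβ := hp.eq
      have key : ∀ ζ, ω.edges = conc (δ.edges ++ T.pathAct h⁻¹ (γ.rest β)) ζ →
          (act (triple γ h δ e₂) ω).edges = conc β.edges (T.seqAct (T.pathφ h⁻¹ (γ.rest β))⁻¹ ζ) := by
        intro ζ hζ
        have : η = conc (T.pathAct h⁻¹ (γ.rest β)) ζ := by
          apply conc_injective δ.edges
          rw [← hη, hζ, conc_append]
        rw [hy, this, T.seqAct_conc, T.pathAct_inv, T.pathφ_inv, ← conc_append, ← hβ]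
      have hmem : ω ∈ (δ.append _ (isPath_left hp e₂)).cylinder ↔
          act (triple γ h δ e₂) ω ∈ β.cylinder := by
        constructor
        · intro hm
          obtain ⟨-, ζ, hζ⟩ := InfPath.mem_cylinder.1 hm
          exact InfPath.mem_cylinder.2 ⟨hyr.trans hp.1, _, key ζ hζ⟩
        · intro hm
          obtain ⟨-, ζ, hζ⟩ := InfPath.mem_cylinder.1 hm
          refine InfPath.mem_cylinder.2 ⟨hr, T.seqAct (T.pathφ h⁻¹ (γ.rest β)) ζ, ?_⟩
          rw [hy, hβ, conc_append] at hζ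
          have h1 := conc_injective _ hζ
          have h2 : η = T.seqAct h⁻¹ (conc (γ.rest β) ζ) := by rw [← h1, T.seqAct_inv']
          rw [hη, h2, T.seqAct_conc, ← conc_append]
          rfl
      refine ⟨⟨fun hm => ⟨hω, hmem.1 hm⟩, fun hm => hmem.2 hm.2⟩, fun hm => ?_⟩
      obtain ⟨-, ζ, hζ⟩ := InfPath.mem_cylinder.1 hm
      refine InfPath.ext ?_
      rw [act_edges hm hζ, act_edges (hmem.1 hm) (key ζ hζ), T.seqAct_mul]
    · have hγ := hq.eq
      have hy' : (act (triple γ h δ e₂) ω).edges =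
          conc β.edges (conc (β.rest γ) (T.seqAct h η)) := by
        rw [hy, ← conc_append, ← hγ]
      have hm : act (triple γ h δ e₂) ω ∈ β.cylinder :=
        InfPath.mem_cylinder.2 ⟨hyr.trans hq.1.symm, _, hy'⟩
      refine ⟨⟨fun _ => ⟨hω, hm⟩, fun _ => hω⟩, fun _ => ?_⟩
      refine InfPath.ext ?_
      rw [act_edges hω hη, act_edges hm hy', T.seqAct_conc, ← conc_append, T.seqAct_mul]
      rfl
    · refine ⟨⟨fun hm => hm.elim, ?_⟩, fun hm => hm.elim⟩
      rintro ⟨-, hm⟩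
      obtain ⟨h1, ζ, h2⟩ := InfPath.mem_cylinder.1 hm
      rw [hy] at h2
      rw [hyr] at h1
      rcases prefix_of_conc_eq _ _ _ _ h2 with h3 | h3
      · exact hp ⟨h1, h3⟩
      · exact hq ⟨h1.symm, h3⟩
  · have hnot : ω ∉ dom (mul (triple α g β e₁) (triple γ h δ e₂)) := by
      rw [mul]
      split_ifs with hp hq
      · intro hm
        obtain ⟨h1, ζ, h2⟩ := InfPath.mem_cylinder.1 hm
        exact hω (InfPath.mem_cylinder.2 ⟨h1, _, h2.trans (conc_append _ _ _)⟩)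
      · exact hω
      · exact fun h => h
    exact ⟨⟨fun h => (hnot h).elim, fun h => (hω h.1).elim⟩, fun h => (hnot h).elim⟩

end SGE

/-- The standard action of `S_{G,E}` on the space `E^∞` of infinite paths:
`(α, g, β) · βη = α(gη)`. -/
noncomputable def pathAction : InvSemigroupAction T.SGE T.InfPath :=
  InvSemigroupAction.ofPartial SGE.dom SGE.act
    (fun x => by
      cases x with
      | zero => exact isOpen_empty
      | triple α g β e => exact InfPath.isOpen_cylinder β)
    SGE.continuousOn_act
    (fun x ω hω => by
      cases x with
      | zero => exact hω.elim
      | triple α g β e =>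
        obtain ⟨h1, η, hη⟩ := InfPath.mem_cylinder.1 hω
        have hm : SGE.act (.triple α g β e) ω ∈ α.cylinder := SGE.act_mem hω
        refine ⟨hm, InfPath.ext ?_⟩
        rw [SGE.star_triple, SGE.act_edges hm (SGE.act_edges hω hη), T.seqAct_inv', hη])
    (fun x y ω => (SGE.mul_dom_act x y ω).1)
    (fun x y ω h1 h2 => (SGE.mul_dom_act x y ω).2 ((SGE.mul_dom_act x y ω).1.2 ⟨h1, h2⟩))
    rfl
    (fun ω => ⟨.triple ⟨ω.rng, [], trivial⟩ 1 ⟨ω.rng, [], trivial⟩ (one_smul _ _).symm,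
      InfPath.mem_cylinder.2 ⟨rfl, ω.edges, rfl⟩⟩)

/-- `(g, γ)` is a `G`-circuit: `γ` is a finite path of positive length with `s(γ) = g r(γ)`. -/
def IsGCircuit (g : G) (γ : T.FinPath) : Prop :=
  γ.edges ≠ [] ∧ γ.src = g • γ.rng

/-- The path `γ = γ₁ … γₙ` has an entry: an edge `a` with `r(a) = r(γᵢ)` and `a ≠ γᵢ` for
some `i`. -/
def HasEntry (γ : T.FinPath) : Prop :=
  ∃ b ∈ γ.edges, ∃ a : E1, T.r a = T.r b ∧ a ≠ b

/-- Row-finiteness: every vertex receives finitely many edges. -/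
def RowFinite : Prop := ∀ x : E0, {a : E1 | T.r a = x}.Finite

/-- No vertex is a source: every vertex receives an edge. -/
def NoSources : Prop := ∀ x : E0, ∃ a : E1, T.r a = x

end SelfSimilarGraph

/-! The implications are proved in the cycle 4 → 1 → 2 → 3 → 4.

Given a finite path μ, prolong it to a path β ending at the range of a G-circuit (g, γ) with an
entry. The element s = (βγ, g, β) maps Z(β) onto Z(βγ) ⊆ Z(β), and the entry supplies a cylinder
Z(βδ) ⊆ Z(β) which this image misses; the idempotents of β and βδ witness 1
(`isLocallyContracting_of_gcircuit`). Without sources, nonzero elements have nonempty domains, so a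
witness F of 1 yields the clopen set V = ⋃ dom f, and the outer cover condition says that s maps V
into V (`pathAction_isLocallyContracting`). Row-finiteness identifies E^∞ equivariantly with the
space of tight filters (`intertwines_tightHomeo`), and the germs of a single element form a
bisection; this gives 3.

The substance is 3 → 4. The map τ induced by a bisection is given by elements of the semigroup only
locally, which leads to `IsPiecewiseContracting`. Suppose that 4 fails at x. A reachable circuit
without an entry would give a one-point open set, which cannot be contracted properly. So no circuit
at all is reachable from x, and an infinite path from x meets each G-orbit of vertices at most once.

By compactness τ is given on V by finitely many triples. Each replaces an initial segment of a path
and preserves the orbits along the tail. Finitely many orbits are available outside the tail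
inherited from ω, so in the iterates τ^k ω this tail starts at a position N_k bounded independently
of k. By compactness some τ^k ω and τ^l ω with k < l agree up to N_l. Since τ^l of a neighbourhood
of ω inside V contains every path agreeing with τ^l ω up to N_l, the point τ^k ω lies in τ^l(V), and
injectivity of τ places ω in τ(V) (`subset_image_of_finite_pieces`). As ω ∈ V was arbitrary, τ(V̄)
is not a proper subset of V. -/

namespace EtaleGroupoid

/-! ### Bisections acting on the unit space -/

variable {X Γ : Type*} [TopologicalSpace X] [TopologicalSpace Γ] (𝒢 : EtaleGroupoid X Γ)

lemma unit_injective : Function.Injective 𝒢.unit := fun x y h => by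
  rw [← 𝒢.src_unit x, h, 𝒢.src_unit]

lemma mul_unit_of_eq {a : Γ} {x : X} (h : 𝒢.src a = 𝒢.rng (𝒢.unit x)) :
    𝒢.mul a (𝒢.unit x) h = a := by
  have hx : x = 𝒢.src a := by rw [h, 𝒢.rng_unit]
  subst hx
  exact 𝒢.mul_unit a

/-- Conjugating a set of units by an open bisection yields the image of the units under the
homeomorphism induced by the bisection. -/
lemma mulSet_conj {B : Set Γ} (hB : InjOn 𝒢.src B) (K : Set X) :
    𝒢.mulSet (𝒢.mulSet B (𝒢.unit '' K)) (𝒢.inv '' B) =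
      𝒢.unit '' (𝒢.rng '' (B ∩ 𝒢.src ⁻¹' K)) := by
  ext c
  constructor
  · rintro ⟨_, ⟨a, ha, _, ⟨x, hx, rfl⟩, h₁, rfl⟩, _, ⟨b, hb, rfl⟩, h₂, rfl⟩
    have hax : 𝒢.src a = x := by rw [h₁, 𝒢.rng_unit]
    -- The product a · x · b⁻¹ is defined only if b has the same source as a, so injectivity of the
    -- source on B leaves only the conjugates a a⁻¹.
    have hab : a = b := hB ha hb (by
      rw [← 𝒢.rng_inv b, ← h₂, 𝒢.src_mul, 𝒢.src_unit, hax])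
    subst hab
    refine ⟨_, ⟨a, ⟨ha, by rwa [mem_preimage, hax]⟩, rfl⟩, ?_⟩
    rw [← 𝒢.mul_inv a]
    congr 1
    exact (𝒢.mul_unit_of_eq h₁).symm
  · rintro ⟨_, ⟨a, ⟨ha, hx⟩, rfl⟩, rfl⟩
    have h₁ : 𝒢.src a = 𝒢.rng (𝒢.unit (𝒢.src a)) := (𝒢.rng_unit _).symm
    refine ⟨_, ⟨a, ha, _, ⟨_, hx, rfl⟩, h₁, rfl⟩, _, ⟨a, ha, rfl⟩, ?_, ?_⟩
    · rw [𝒢.src_mul, 𝒢.src_unit, 𝒢.rng_inv]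
    · rw [← 𝒢.mul_inv a]
      congr 1
      exact (𝒢.mul_unit_of_eq h₁).symm

/-- A product a⁻¹ b has the source of b. This extracts from V̄ ⊆ B⁻¹B that the map induced by B is
defined on all of V̄. -/
lemma subset_src_image_of_unit_image_subset {B : Set Γ} {K : Set X}
    (h : 𝒢.unit '' K ⊆ 𝒢.mulSet (𝒢.inv '' B) B) : K ⊆ 𝒢.src '' B := by
  intro x hx
  obtain ⟨_, ⟨a, ha, rfl⟩, b, hb, hab, h'⟩ := h ⟨x, hx, rfl⟩
  refine ⟨b, hb, ?_⟩
  rw [← 𝒢.src_mul _ b hab, ← h', 𝒢.src_unit]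

lemma unit_image_ssubset {K L : Set X} : 𝒢.unit '' K ⊂ 𝒢.unit '' L ↔ K ⊂ L := by
  simp only [ssubset_iff_subset_ne, image_subset_image_iff 𝒢.unit_injective, ne_eq,
    𝒢.unit_injective.image_injective.eq_iff]

end EtaleGroupoid

/-! ### Contraction for an action, for its germs, and under conjugacy -/

namespace InvSemigroupAction

open InverseSemigroup

variable {S X Y : Type*} [InverseSemigroup S] [TopologicalSpace X] [TopologicalSpace Y]

/-- The germs of one element s at all points of its domain form an open bisection, and conjugation
by this bisection is θ_s on units. -/
lemma IsLocallyContracting.germGroupoid {A : InvSemigroupAction S X}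
    (h : A.IsLocallyContracting) : A.germGroupoid.IsLocallyContracting := by
  intro U hU hne
  obtain ⟨V, s, hV, hVne, hVU, hVs, hlt⟩ := h U hU hne
  have hsrc : InjOn A.germGroupoid.src (A.Θ s (A.θ s).source) := by
    rintro _ ⟨x, -, hx, rfl⟩ _ ⟨y, -, hy, rfl⟩ (hxy : x = y)
    subst hxy
    rfl
  refine ⟨V, A.Θ s (A.θ s).source, hV, hVne, hVU,
    ⟨A.isOpen_Θ s (A.θ s).open_source subset_rfl, hsrc, ?_⟩, ?_, ?_⟩
  · rintro _ ⟨x, -, hx, rfl⟩ _ ⟨y, -, hy, rfl⟩ hxy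
    have hxy' : x = y := (A.θ s).injOn hx hy hxy
    subst hxy'
    rfl
  · rintro _ ⟨x, hx, rfl⟩
    have hm : A.germ s x (hVs hx) ∈ A.Θ s (A.θ s).source := ⟨x, hVs hx, hVs hx, rfl⟩
    exact ⟨_, ⟨_, hm, rfl⟩, _, hm, A.germGroupoid.src_inv _, (A.germGroupoid.inv_mul (A.germ s x (hVs hx))).symm⟩
  · rw [A.germGroupoid.mulSet_conj hsrc, A.germGroupoid.unit_image_ssubset]
    convert hlt using 1
    ext y
    constructor
    · rintro ⟨_, ⟨⟨x, -, hx, rfl⟩, hxV⟩, rfl⟩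
      exact ⟨x, hxV, rfl⟩
    · rintro ⟨x, hxV, rfl⟩
      exact ⟨A.germ s x (hVs hxV), ⟨⟨x, hVs hxV, hVs hxV, rfl⟩, hxV⟩, rfl⟩

/-- A weak form of local contraction, in which the contracting map is only required to be given
locally by elements of the inverse semigroup. -/
def IsPiecewiseContracting (A : InvSemigroupAction S X) : Prop :=
  ∀ U : Set X, IsOpen U → U.Nonempty →
    ∃ (V : Set X) (τ : X → X), IsOpen V ∧ V.Nonempty ∧ V ⊆ U ∧ InjOn τ (closure V) ∧
      (∀ x ∈ closure V, ∃ s : S, ∃ O : Set X, IsOpen O ∧ x ∈ O ∧ O ⊆ (A.θ s).source ∧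
        ∀ y ∈ O, τ y = A.θ s y) ∧ τ '' closure V ⊂ V

/-- A bisection B induces the map τ sending the source of b to the range of b. It is injective
because the range map is, and it agrees near each point with some θ_s because B contains a basic set
Θ(s, O) around each of its germs. In general no single s serves for the whole of B. -/
lemma isPiecewiseContracting_of_germGroupoid {A : InvSemigroupAction S X}
    (h : A.germGroupoid.IsLocallyContracting) : A.IsPiecewiseContracting := by
  classical
  intro U hU hne
  obtain ⟨V, B, hV, hVne, hVU, ⟨hBo, hsrc, hrng⟩, hVB, hlt⟩ := h U hU hne
  have hVB' := A.germGroupoid.subset_src_image_of_unit_image_subset hVB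
  rw [A.germGroupoid.mulSet_conj hsrc, A.germGroupoid.unit_image_ssubset] at hlt
  -- The identity off the sources of B is a default value; V̄ lies inside those sources.
  let τ : X → X := fun x => if h : ∃ b ∈ B, A.src b = x then A.rng h.choose else x
  have hτ : ∀ b ∈ B, τ (A.src b) = A.rng b := by
    intro b hb
    have hex : ∃ b' ∈ B, A.src b' = A.src b := ⟨b, hb, rfl⟩
    simp only [τ, dif_pos hex]
    exact congrArg A.rng (hsrc hex.choose_spec.1 hb hex.choose_spec.2)
  refine ⟨V, τ, hV, hVne, hVU, ?_, ?_, ?_⟩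
  · intro x hx y hy hxy
    obtain ⟨a, ha, rfl⟩ := hVB' hx
    obtain ⟨b, hb, rfl⟩ := hVB' hy
    rw [show τ (A.germGroupoid.src a) = A.rng a from hτ a ha,
      show τ (A.germGroupoid.src b) = A.rng b from hτ b hb] at hxy
    rw [hrng ha hb hxy]
  · intro x hx
    obtain ⟨b, hb, rfl⟩ := hVB' hx
    obtain ⟨s, x, hxs, rfl⟩ := A.exists_rep b
    obtain ⟨O, hO, hOs, hxO, hOB⟩ := A.exists_Θ_subset hBo hxs hb
    exact ⟨s, O, hO, hxO, hOs, fun y hy => hτ _ (hOB ⟨y, hy, hOs hy, rfl⟩)⟩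
  · convert hlt using 1
    ext y
    constructor
    · rintro ⟨x, hx, rfl⟩
      obtain ⟨b, hb, rfl⟩ := hVB' hx
      exact ⟨b, ⟨hb, hx⟩, (hτ b hb).symm⟩
    · rintro ⟨b, ⟨hb, hx⟩, rfl⟩
      exact ⟨_, hx, hτ b hb⟩

/-- A homeomorphism intertwines two actions. -/
structure Intertwines (A : InvSemigroupAction S X) (A' : InvSemigroupAction S Y) (e : X ≃ₜ Y) :
    Prop where
  mem_iff : ∀ s x, x ∈ (A.θ s).source ↔ e x ∈ (A'.θ s).source
  map : ∀ s x, x ∈ (A.θ s).source → e (A.θ s x) = A'.θ s (e x)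

lemma IsLocallyContracting.of_intertwines {A : InvSemigroupAction S X}
    {A' : InvSemigroupAction S Y} {e : X ≃ₜ Y} (he : Intertwines A A' e)
    (h : A.IsLocallyContracting) : A'.IsLocallyContracting := by
  intro U hU hne
  obtain ⟨V, s, hV, hVne, hVU, hVs, hlt⟩ := h (e ⁻¹' U) (hU.preimage e.continuous)
    (hne.preimage e.surjective)
  have himg : A'.θ s '' (e '' closure V) = e '' (A.θ s '' closure V) := by
    rw [image_image, image_image]
    exact image_congr fun x hx => (he.map s x (hVs hx)).symm
  refine ⟨e '' V, s, e.isOpenMap V hV, hVne.image e, image_subset_iff.2 hVU, ?_, ?_⟩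
  · rw [← e.image_closure]
    rintro _ ⟨x, hx, rfl⟩
    exact (he.mem_iff s x).1 (hVs hx)
  · rw [← e.image_closure, himg]
    exact e.injective.image_strictMono hlt

lemma IsPiecewiseContracting.of_intertwines {A : InvSemigroupAction S X}
    {A' : InvSemigroupAction S Y} {e : Y ≃ₜ X} (he : Intertwines A' A e)
    (h : A.IsPiecewiseContracting) : A'.IsPiecewiseContracting := by
  intro U hU hne
  obtain ⟨V, τ, hV, hVne, hVU, hinj, hloc, hlt⟩ := h (e.symm ⁻¹' U)
    (hU.preimage e.symm.continuous) (hne.preimage e.symm.surjective)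
  have hcl : closure (e ⁻¹' V) = e ⁻¹' closure V := (e.preimage_closure V).symm
  have himg : (fun y => e.symm (τ (e y))) '' (e ⁻¹' closure V) = e ⁻¹' (τ '' closure V) := by
    rw [← e.image_symm, image_image, image_image]
    simp
  refine ⟨e ⁻¹' V, fun y => e.symm (τ (e y)), hV.preimage e.continuous, hVne.preimage e.surjective,
    fun y hy => by simpa using hVU hy, ?_, ?_, ?_⟩
  · rw [hcl]
    intro x hx y hy hxy
    exact e.injective (hinj hx hy (e.symm.injective hxy))
  · rw [hcl]
    intro y hy
    obtain ⟨s, O, hO, hyO, hOs, hτ⟩ := hloc (e y) hy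
    refine ⟨s, e ⁻¹' O, hO.preimage e.continuous, hyO, fun z hz => (he.mem_iff s z).2 (hOs hz), ?_⟩
    intro z hz
    simp only
    rw [hτ _ hz, e.symm_apply_eq, he.map s z ((he.mem_iff s z).2 (hOs hz))]
  · rw [hcl, himg, ← e.image_symm]
    exact e.symm.injective.image_strictMono hlt

end InvSemigroupAction

/-! ### Topology of the space of infinite paths -/

namespace SelfSimilarGraph

variable {G E0 E1 : Type*} [Group G] [MulAction G E0] [MulAction G E1]
  {T : SelfSimilarGraph G E0 E1}

lemma conc_getElem (l : List E1) (η : ℕ → E1) (i : ℕ) (hi : i < l.length) :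
    conc l η i = l[i] := by
  induction l generalizing i with
  | nil => simp at hi
  | cons a l ih =>
    cases i with
    | zero => rfl
    | succ i => exact ih i (by simpa using hi)

namespace InfPath

lemma mem_cylinder_iff {α : T.FinPath} {ω : T.InfPath} :
    ω ∈ α.cylinder ↔ ω.rng = α.rng ∧ ∀ i (h : i < α.edges.length), ω.edges i = α.edges[i] := by
  rw [mem_cylinder]
  refine and_congr_right fun _ => ⟨?_, fun h => ⟨_, conc_drop α.edges (η := ω.edges) fun i hi => ?_⟩⟩
  · rintro ⟨η, hη⟩ i hi
    rw [hη, conc_getElem _ _ _ hi]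
  · rw [h i hi, conc_getElem _ _ _ hi]

lemma rng_of_mem_cylinder {α : T.FinPath} {ω : T.InfPath} (h : ω ∈ α.cylinder) :
    ω.rng = α.rng := (mem_cylinder.1 h).1

/-- The paths with the same range and the same first `n` edges as `ω`. -/
def agreeSet (ω : T.InfPath) (n : ℕ) : Set T.InfPath :=
  {η | η.rng = ω.rng ∧ ∀ i < n, η.edges i = ω.edges i}

lemma mem_agreeSet_self (ω : T.InfPath) (n : ℕ) : ω ∈ ω.agreeSet n := ⟨rfl, fun _ _ => rfl⟩

lemma agreeSet_symm {ω η : T.InfPath} {n : ℕ} (h : η ∈ ω.agreeSet n) : ω ∈ η.agreeSet n :=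
  ⟨h.1.symm, fun i hi => (h.2 i hi).symm⟩

lemma agreeSet_trans {ω η ζ : T.InfPath} {n : ℕ} (h : η ∈ ω.agreeSet n) (h' : ζ ∈ η.agreeSet n) :
    ζ ∈ ω.agreeSet n :=
  ⟨h'.1.trans h.1, fun i hi => (h'.2 i hi).trans (h.2 i hi)⟩

lemma agreeSet_anti (ω : T.InfPath) {m n : ℕ} (h : m ≤ n) : ω.agreeSet n ⊆ ω.agreeSet m :=
  fun _ hη => ⟨hη.1, fun i hi => hη.2 i (hi.trans_le h)⟩

/-- Membership in Z(α) depends only on the range and the first |α| edges. Hence cylinders are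
clopen, and two cylinders with a common point are nested. -/
lemma mem_cylinder_of_agree {α : T.FinPath} {ω η : T.InfPath} (h : ω ∈ α.cylinder)
    (hη : η ∈ ω.agreeSet α.edges.length) : η ∈ α.cylinder := by
  rw [mem_cylinder_iff] at h ⊢
  exact ⟨hη.1.trans h.1, fun i hi => (hη.2 i hi).trans (h.2 i hi)⟩

lemma cylinder_eq_agreeSet {α : T.FinPath} {ω : T.InfPath} (h : ω ∈ α.cylinder) :
    α.cylinder = ω.agreeSet α.edges.length := by
  refine Subset.antisymm (fun η hη => ?_) fun η hη => mem_cylinder_of_agree h hη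
  rw [mem_cylinder_iff] at h hη
  exact ⟨hη.1.trans h.1.symm, fun i hi => (hη.2 i hi).trans (h.2 i hi).symm⟩

/-- The initial segment of length `n` of an infinite path. -/
def take (ω : T.InfPath) (n : ℕ) : T.FinPath :=
  ⟨ω.rng, List.ofFn fun i : Fin n => ω.edges i, by
    have h : ω.edges = conc (List.ofFn fun i : Fin n => ω.edges i) _ :=
      conc_drop _ (η := ω.edges) fun i hi => by
        rw [conc_getElem _ _ _ hi, List.getElem_ofFn]
    have hp := ω.isPath
    rw [h] at hp
    exact (T.endpoint_eq_of_conc ω.rng _ _ (by rw [← h]; rfl) hp).1⟩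

@[simp] lemma length_take (ω : T.InfPath) (n : ℕ) : (ω.take n).edges.length = n := by
  simp [take]

lemma mem_cylinder_take (ω : T.InfPath) (n : ℕ) : ω ∈ (ω.take n).cylinder :=
  mem_cylinder_iff.2 ⟨rfl, fun i hi => by simp [take]⟩

lemma cylinder_take (ω : T.InfPath) (n : ℕ) : (ω.take n).cylinder = ω.agreeSet n := by
  rw [cylinder_eq_agreeSet (ω.mem_cylinder_take n), length_take]

lemma eq_take {α : T.FinPath} {ω : T.InfPath} (h : ω ∈ α.cylinder) :
    α = ω.take α.edges.length := by
  rw [mem_cylinder_iff] at h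
  refine FinPath.ext h.1.symm (List.ext_getElem (by simp) fun i h₁ h₂ => ?_)
  simp [take, h.2 i h₁]

lemma src_take (ω : T.InfPath) (n : ℕ) : (ω.take n).src = T.r (ω.edges n) := by
  rw [src_eq_rng_drop (ω.mem_cylinder_take n), length_take]
  simp [rng, drop]

lemma isPrefix_of_mem {α β : T.FinPath} {ω : T.InfPath} (hα : ω ∈ α.cylinder)
    (hβ : ω ∈ β.cylinder) (h : α.edges.length ≤ β.edges.length) : α.IsPrefix β := by
  rw [mem_cylinder_iff] at hα hβ
  refine ⟨hα.1.symm.trans hβ.1, ?_⟩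
  rw [List.prefix_iff_getElem]
  exact ⟨h, fun i hi => (hα.2 i hi).symm.trans (hβ.2 i (hi.trans_le h))⟩

lemma isOpen_agreeSet (ω : T.InfPath) (n : ℕ) : IsOpen (ω.agreeSet n) := by
  rw [← cylinder_take]
  exact isOpen_cylinder _

lemma isClosed_cylinder (α : T.FinPath) : IsClosed α.cylinder := by
  refine ⟨isOpen_iff_forall_mem_open.2 fun ω hω => ⟨ω.agreeSet α.edges.length, fun η hη hηα => ?_,
    ω.isOpen_agreeSet _, ω.mem_agreeSet_self _⟩⟩
  exact hω (mem_cylinder_of_agree hηα (agreeSet_symm hη))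

/-- The cylinders containing ω are exactly the sets `ω.agreeSet n`, which decrease with n, so the
topology generated by cylinders has them as a neighbourhood base at ω. -/
lemma exists_agreeSet_subset {U : Set T.InfPath} (hU : IsOpen U) {ω : T.InfPath} (hω : ω ∈ U) :
    ∃ n, ω.agreeSet n ⊆ U := by
  induction hU with
  | basic U hU =>
    obtain ⟨α, rfl⟩ := hU
    exact ⟨_, fun η hη => mem_cylinder_of_agree hω hη⟩
  | univ => exact ⟨0, subset_univ _⟩
  | inter U V _ _ ih₁ ih₂ =>
    obtain ⟨m, hm⟩ := ih₁ hω.1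
    obtain ⟨n, hn⟩ := ih₂ hω.2
    exact ⟨max m n, subset_inter ((ω.agreeSet_anti (le_max_left _ _)).trans hm)
      ((ω.agreeSet_anti (le_max_right _ _)).trans hn)⟩
  | sUnion 𝒰 _ ih =>
    obtain ⟨U, hU, hωU⟩ := hω
    obtain ⟨n, hn⟩ := ih U hU hωU
    exact ⟨n, hn.trans (subset_sUnion_of_mem hU)⟩

end InfPath

lemma NoSources.exists_infPath (h : T.NoSources) (x : E0) : ∃ ω : T.InfPath, ω.rng = x := by
  choose e he using h
  -- Start at x, choose an edge with range the current vertex, move to its source, and repeat.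
  let v : ℕ → E0 := fun n => Nat.rec x (fun _ y => T.s (e y)) n
  exact ⟨⟨fun n => e (v n), fun n => (he _).symm⟩, he x⟩

lemma NoSources.cylinder_nonempty (h : T.NoSources) (α : T.FinPath) : α.cylinder.Nonempty := by
  obtain ⟨ω, hω⟩ := h.exists_infPath α.src
  exact ⟨_, ω, hω.symm, rfl⟩

/-- In a row-finite graph the set of infinite paths with a given range is compact. -/
lemma RowFinite.isCompact_rng (h : T.RowFinite) (x : E0) :
    IsCompact {ω : T.InfPath | ω.rng = x} := by
  refine isCompact_iff_ultrafilter_le_nhds.2 fun F hF => ?_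
  have hx : ∀ᶠ ω in (F : Filter T.InfPath), ω.rng = x := Filter.le_principal_iff.1 hF
  -- Once the ultrafilter F fixes the range of the n-th edge, only finitely many values remain for
  -- that edge, and F selects one. Starting from the range x, this decides all edges in turn; the
  -- selected edges form the limit path.
  have step : ∀ (n : ℕ) (y : E0), (∀ᶠ ω in (F : Filter T.InfPath), T.r (ω.edges n) = y) →
      ∃ a, T.r a = y ∧ ∀ᶠ ω in (F : Filter T.InfPath), ω.edges n = a := by
    intro n y hy
    exact (Ultrafilter.eventually_exists_mem_iff (h y)).1
      (hy.mono fun ω hω => ⟨ω.edges n, hω, rfl⟩)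
  have hex : ∀ n, ∃ a, ∀ᶠ ω in (F : Filter T.InfPath), ω.edges n = a := by
    intro n
    induction n with
    | zero =>
      obtain ⟨a, -, ha⟩ := step 0 x hx
      exact ⟨a, ha⟩
    | succ n ih =>
      obtain ⟨a, ha⟩ := ih
      obtain ⟨b, -, hb⟩ := step (n + 1) (T.s a) (ha.mono fun ω hω => by rw [← ω.isPath, hω])
      exact ⟨b, hb⟩
  choose a ha using hex
  have hp : ∀ n, T.s (a n) = T.r (a (n + 1)) := fun n => by
    obtain ⟨ω, h₁, h₂⟩ := ((ha n).and (ha (n + 1))).exists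
    rw [← h₁, ← h₂, ω.isPath]
  obtain ⟨ω₀, h₀, h₀'⟩ := (hx.and (ha 0)).exists
  have hax : InfPath.rng (⟨a, hp⟩ : T.InfPath) = x := by
    rw [← h₀, InfPath.rng, InfPath.rng, h₀']
  refine ⟨⟨a, hp⟩, hax, fun N hN => ?_⟩
  obtain ⟨U, hUN, hU, haU⟩ := mem_nhds_iff.1 hN
  obtain ⟨n, hn⟩ := InfPath.exists_agreeSet_subset hU haU
  have hev : ∀ᶠ ω in (F : Filter T.InfPath), ∀ i ∈ Finset.range n, ω.edges i = a i :=
    (Filter.eventually_all_finset _).2 fun i _ => ha i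
  filter_upwards [hx, hev] with ω h₁ h₂
  exact hUN (hn ⟨h₁.trans hax.symm, fun i hi => h₂ i (Finset.mem_range.2 hi)⟩)

/-! ### Idempotents and domains -/

namespace SGE

/-- The idempotent `(α, 1, α)`. -/
def idem (α : T.FinPath) : T.SGE := triple α 1 α (one_smul _ _).symm

lemma isIdempotentElem_idem (α : T.FinPath) : IsIdempotentElem (idem α) := by
  unfold IsIdempotentElem idem
  rw [triple_mul_triple_self]
  exact triple_congr rfl (mul_one _) rfl

lemma idem_ne_zero (α : T.FinPath) : idem α ≠ 0 := fun h => by cases h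

lemma idem_mul_idem {α β : T.FinPath} (h : α.IsPrefix β) : idem β * idem α = idem β := by
  rw [mul_def, idem, idem, mul, dif_pos h]
  refine triple_congr rfl ?_ (FinPath.ext h.1 ?_)
  · rw [inv_one, T.pathφ_one, inv_one, one_mul]
  · rw [h.eq]
    change α.edges ++ T.pathAct 1⁻¹ (α.rest β) = _
    rw [inv_one, T.pathAct_one]

lemma exists_idem {e : T.SGE} (he : IsIdempotentElem e) (h0 : e ≠ 0) : ∃ α, e = idem α :=
  (idem_eq e he).resolve_left h0

lemma star_mul_self (α : T.FinPath) (g : G) (β : T.FinPath) (h) :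
    star (triple α g β h) * triple α g β h = idem β := by
  rw [star_triple, triple_mul_triple_self]
  exact triple_congr rfl (inv_mul_cancel g) rfl

lemma dom_idem (α : T.FinPath) : dom (idem α) = α.cylinder := rfl

lemma isOpen_dom (s : T.SGE) : IsOpen (dom s) := (T.pathAction.θ s).open_source

lemma isClosed_dom (s : T.SGE) : IsClosed (dom s) := by
  cases s with
  | zero => exact isClosed_empty
  | triple α g β h => exact InfPath.isClosed_cylinder β

lemma mem_dom_mul {s t : T.SGE} {ω : T.InfPath} :
    ω ∈ dom (s * t) ↔ ω ∈ dom t ∧ act t ω ∈ dom s := T.pathAction.mem_mul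

lemma mem_dom_mul_idem {s e : T.SGE} (he : IsIdempotentElem e) {ω : T.InfPath} :
    ω ∈ dom (s * e) ↔ ω ∈ dom e ∧ ω ∈ dom s := T.pathAction.mem_mul_idem he

lemma act_mem_dom_star {s : T.SGE} {ω : T.InfPath} (hω : ω ∈ dom s) : act s ω ∈ dom (star s) :=
  T.pathAction.apply_mem_star hω

lemma act_star_act {s : T.SGE} {ω : T.InfPath} (hω : ω ∈ dom s) : act (star s) (act s ω) = ω :=
  T.pathAction.star_apply hω

/-- The order on idempotents becomes inclusion of domains. Together with `dom_nonempty` this lets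
algebraic conditions on idempotents be tested on points of E^∞. -/
lemma dom_subset_of_mul_eq {e s : T.SGE} (hs : IsIdempotentElem s) (h : e * s = e) :
    dom e ⊆ dom s := fun _ hω => ((mem_dom_mul_idem hs).1 (h.symm ▸ hω)).1

lemma mem_dom_conj {s f : T.SGE} (hf : IsIdempotentElem f) {ω : T.InfPath} :
    ω ∈ dom (star s * f * s) ↔ ω ∈ dom s ∧ act s ω ∈ dom f := by
  rw [mem_dom_mul, mem_dom_mul_idem hf]
  exact ⟨fun h => ⟨h.1, h.2.1⟩, fun h => ⟨h.1, h.2, act_mem_dom_star h.1⟩⟩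

/-- With no sources every finite path extends to an infinite one. Consequently a product is nonzero
as soon as, and only if, some infinite path lies in its domain; most later uses of the absence of
sources pass through this. -/
lemma dom_nonempty (hsrc : T.NoSources) {s : T.SGE} (h : s ≠ 0) : (dom s).Nonempty := by
  cases s with
  | zero => exact (h rfl).elim
  | triple α g β e => exact hsrc.cylinder_nonempty β

lemma ne_zero_of_mem_dom {s : T.SGE} {ω : T.InfPath} (h : ω ∈ dom s) : s ≠ 0 := by
  rintro rfl
  exact h

end SGE

end SelfSimilarGraph

/-! ### From circuits with entries to contracting semigroup and action -/

namespace SelfSimilarGraph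

variable {G E0 E1 : Type*} [Group G] [MulAction G E0] [MulAction G E1]
  {T : SelfSimilarGraph G E0 E1}

open InverseSemigroup

/-- A path with an entry is disjoint from some other path with the same range. -/
lemma HasEntry.exists_disjoint {γ : T.FinPath} (h : T.HasEntry γ) :
    ∃ δ : T.FinPath, δ.rng = γ.rng ∧ ¬ δ.edges <+: γ.edges ∧ ¬ γ.edges <+: δ.edges := by
  obtain ⟨b, hb, a, hr, hab⟩ := h
  obtain ⟨l, m, hlm⟩ := List.append_of_mem hb
  have hp := γ.isPath
  rw [hlm, T.isPath_append] at hp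
  -- Follow γ up to just before the edge b, then leave it through the entry a. The last edge differs
  -- from the edge of γ in that position, so neither path extends the other.
  refine ⟨⟨γ.rng, l ++ [a], (T.isPath_append _ _ _).2 ⟨hp.1, hr.trans hp.2.1, trivial⟩⟩,
    rfl, ?_, ?_⟩
  · rw [hlm, List.prefix_append_right_inj]
    simp [List.cons_prefix_cons, hab]
  · rw [hlm, List.prefix_append_right_inj]
    simp [List.cons_prefix_cons, hab.symm]

/-- Going round the circuit once is a contraction: prefixing γ sends Z(β) into Z(βγ), and a path δ
branching off γ marks a part of Z(β) outside the image. -/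
lemma isLocallyContracting_of_gcircuit (hsrc : T.NoSources)
    (h : ∀ x : E0, ∃ α : T.FinPath, α.rng = x ∧
      ∃ (g : G) (γ : T.FinPath), T.IsGCircuit g γ ∧ T.HasEntry γ ∧ α.src = γ.rng) :
    InverseSemigroup.IsLocallyContracting T.SGE := by
  classical
  intro e he he0
  obtain ⟨μ, rfl⟩ := SGE.exists_idem he he0
  obtain ⟨α, hα, g, γ, ⟨-, hγ⟩, hent, hαγ⟩ := h μ.src
  obtain ⟨δ, hδ, hd₁, hd₂⟩ := hent.exists_disjoint
  let β : T.FinPath := μ.append α.edges (hα ▸ α.isPath)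
  have hβ : β.src = γ.rng := by
    rw [← hαγ, FinPath.src_append, ← hα]
    rfl
  let βγ : T.FinPath := β.append γ.edges (hβ ▸ γ.isPath)
  let βδ : T.FinPath := β.append δ.edges (hβ ▸ hδ ▸ δ.isPath)
  have hs : βγ.src = g • β.src := by
    rw [FinPath.src_append, hβ, ← hγ]
    rfl
  have hμβ : μ.IsPrefix β := ⟨rfl, List.prefix_append _ _⟩
  have hβγ : β.IsPrefix βγ := ⟨rfl, List.prefix_append _ _⟩
  have hβδ : β.IsPrefix βδ := ⟨rfl, List.prefix_append _ _⟩
  have hdisj : ∀ ω : T.InfPath, ω ∈ βγ.cylinder → ω ∈ βδ.cylinder → False := by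
    intro ω h₁ h₂
    rcases le_total βγ.edges.length βδ.edges.length with hl | hl
    · exact hd₂ ((List.prefix_append_right_inj _).1 (InfPath.isPrefix_of_mem h₁ h₂ hl).2)
    · exact hd₁ ((List.prefix_append_right_inj _).1 (InfPath.isPrefix_of_mem h₂ h₁ hl).2)
  let s : T.SGE := .triple βγ g β hs
  have hsub : βγ.cylinder ⊆ β.cylinder := by
    rw [← SGE.dom_idem, ← SGE.dom_idem]
    exact SGE.dom_subset_of_mul_eq (SGE.isIdempotentElem_idem β) (SGE.idem_mul_idem hβγ)
  have hle : SGE.idem μ * (star s * s) = SGE.idem β := by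
    rw [SGE.star_mul_self, idem_comm _ _ (SGE.isIdempotentElem_idem _)
      (SGE.isIdempotentElem_idem _), SGE.idem_mul_idem hμβ]
  -- The idempotent of β, the larger of the two, does the covering; the idempotent of βδ serves as
  -- f₀ and keeps away from the range of s.
  refine ⟨s, {SGE.idem β, SGE.idem βδ}, SGE.idem βδ, by simp, ?_⟩
  have key : ∀ f : T.SGE, IsIdempotentElem f → IsOuterCover {SGE.idem β, SGE.idem βδ}
      (s * f * star s) ∧ SGE.idem βδ * s * f = 0 := by
    intro f hf
    constructor
    · intro k hk hk0 hkf
      -- The domain of s f s* lies in Z(βγ) ⊆ Z(β), so everything nonzero below s f s* meets β.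
      refine ⟨SGE.idem β, by simp, ?_⟩
      obtain ⟨ω, hω⟩ := SGE.dom_nonempty hsrc hk0
      refine SGE.ne_zero_of_mem_dom ((SGE.mem_dom_mul_idem hk).2 ⟨hω, ?_⟩)
      exact hsub (SGE.mem_dom_mul.1 (SGE.dom_subset_of_mul_eq (idem_conj' s hf) hkf hω)).1
    · by_contra h0
      obtain ⟨ω, hω⟩ := SGE.dom_nonempty hsrc h0
      have h₁ := SGE.mem_dom_mul.1 ((SGE.mem_dom_mul_idem hf).1 hω).2
      exact hdisj _ (SGE.act_mem h₁.1) h₁.2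
  intro f hf
  rw [Finset.mem_insert, Finset.mem_singleton] at hf
  rw [hle]
  rcases hf with rfl | rfl
  · exact ⟨SGE.isIdempotentElem_idem _, SGE.idem_ne_zero _, SGE.isIdempotentElem_idem _,
      key _ (SGE.isIdempotentElem_idem _)⟩
  · exact ⟨SGE.isIdempotentElem_idem _, SGE.idem_ne_zero _, SGE.idem_mul_idem hβδ,
      key _ (SGE.isIdempotentElem_idem _)⟩

/-- Finite unions of domains are clopen, so V = ⋃ dom f is its own closure. The outer cover
condition makes F dense in the image of V, hence s maps V into the closed set V; the relations f₀ s
f = 0 keep dom f₀ out of the image. -/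
lemma pathAction_isLocallyContracting (hsrc : T.NoSources)
    (h : InverseSemigroup.IsLocallyContracting T.SGE) : T.pathAction.IsLocallyContracting := by
  intro U hU ⟨ω, hω⟩
  obtain ⟨n, hn⟩ := InfPath.exists_agreeSet_subset hU hω
  obtain ⟨s, F, f₀, hf₀, hF⟩ := h (SGE.idem (ω.take n)) (SGE.isIdempotentElem_idem _)
    (SGE.idem_ne_zero _)
  set V : Set T.InfPath := ⋃ f ∈ F, SGE.dom f with hVdef
  have hVo : IsOpen V := isOpen_biUnion fun f _ => SGE.isOpen_dom f
  have hVc : IsClosed V := F.finite_toSet.isClosed_biUnion fun f _ => SGE.isClosed_dom f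
  have hfe : ∀ f ∈ F, SGE.dom f ⊆ SGE.dom (SGE.idem (ω.take n)) ∩ SGE.dom s := by
    intro f hf η hη
    obtain ⟨hfi, -, hfe, -⟩ := hF f hf
    have hi := SGE.isIdempotentElem_idem (ω.take n)
    have h₁ := SGE.dom_subset_of_mul_eq (idem_mul hi (idem_star_mul s)) hfe hη
    rw [SGE.mem_dom_mul_idem (idem_star_mul s)] at h₁
    exact ⟨h₁.2, (SGE.mem_dom_mul.1 h₁.1).1⟩
  have hVs : V ⊆ SGE.dom s := iUnion₂_subset fun f hf => (hfe f hf).trans inter_subset_right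
  obtain ⟨η₀, hη₀⟩ := SGE.dom_nonempty hsrc (hF f₀ hf₀).2.1
  have hη₀V : η₀ ∈ V := mem_biUnion hf₀ hη₀
  refine ⟨V, s, hVo, ⟨η₀, hη₀V⟩, ?_, hVc.closure_eq.symm ▸ hVs, ?_⟩
  · refine iUnion₂_subset fun f hf => ((hfe f hf).trans inter_subset_left).trans ?_
    rw [SGE.dom_idem, InfPath.cylinder_take]
    exact hn
  · rw [hVc.closure_eq]
    refine (ssubset_iff_of_subset ?_).2 ⟨η₀, hη₀V, ?_⟩
    · rintro _ ⟨η, hη, rfl⟩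
      change SGE.act s η ∈ V
      obtain ⟨f, hf, hηf⟩ := mem_iUnion₂.1 hη
      obtain ⟨hfi, -, -, hcov, -⟩ := hF f hf
      by_contra hnot
      have hsη := hVs hη
      have hmem : SGE.act s η ∈ SGE.dom (s * f * star s) := by
        refine SGE.mem_dom_mul.2 ⟨SGE.act_mem_dom_star hsη, ?_⟩
        rw [SGE.act_star_act hsη]
        exact (SGE.mem_dom_mul_idem hfi).2 ⟨hηf, hsη⟩
      obtain ⟨κ, hκ⟩ := SGE.exists_idem (idem_conj' s hfi) (SGE.ne_zero_of_mem_dom hmem)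
      obtain ⟨N, hN⟩ := InfPath.exists_agreeSet_subset hVc.isOpen_compl hnot
      rw [hκ] at hmem hcov
      -- Length N makes the cylinder of the initial segment of sη miss V; length |κ| puts its
      -- idempotent below s f s*. Together they contradict the outer cover condition.
      set M := max N κ.edges.length
      obtain ⟨f', hf', hne⟩ := hcov (SGE.idem ((SGE.act s η).take M))
        (SGE.isIdempotentElem_idem _) (SGE.idem_ne_zero _)
        (SGE.idem_mul_idem (InfPath.isPrefix_of_mem hmem (InfPath.mem_cylinder_take _ _)
          (by rw [InfPath.length_take]; exact le_max_right _ _)))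
      obtain ⟨ζ, hζ⟩ := SGE.dom_nonempty hsrc hne
      rw [SGE.mem_dom_mul_idem (SGE.isIdempotentElem_idem _), SGE.dom_idem,
        InfPath.cylinder_take] at hζ
      exact hN (InfPath.agreeSet_anti _ (le_max_left _ _) hζ.1) (mem_biUnion hf' hζ.2)
    · rintro ⟨η, hη, hηe : SGE.act s η = η₀⟩
      obtain ⟨f, hf, hηf⟩ := mem_iUnion₂.1 hη
      obtain ⟨hfi, -, -, -, h0⟩ := hF f hf
      refine SGE.ne_zero_of_mem_dom (s := f₀ * s * f) (ω := η) ?_ h0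
      refine (SGE.mem_dom_mul_idem hfi).2 ⟨hηf, SGE.mem_dom_mul.2 ⟨hVs hη, ?_⟩⟩
      rwa [hηe]

end SelfSimilarGraph

/-! ### Infinite paths as tight filters -/

namespace SelfSimilarGraph

variable {G E0 E1 : Type*} [Group G] [MulAction G E0] [MulAction G E1]
  {T : SelfSimilarGraph G E0 E1}

open InverseSemigroup

namespace InfPath

lemma eq_of_agree {ω η : T.InfPath} (h : ∀ n, η ∈ ω.agreeSet n) : η = ω :=
  InfPath.ext (funext fun n => (h (n + 1)).2 n (Nat.lt_succ_self n))

lemma eventually_idem_take_mul {e : T.SGE} (he : IsIdempotentElem e) {ω : T.InfPath}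
    (hω : ω ∈ SGE.dom e) :
    ∀ᶠ n in Filter.atTop, SGE.idem (ω.take n) * e = SGE.idem (ω.take n) := by
  obtain ⟨α, rfl⟩ := SGE.exists_idem he (SGE.ne_zero_of_mem_dom hω)
  filter_upwards [Filter.eventually_ge_atTop α.edges.length] with n hn
  exact SGE.idem_mul_idem (isPrefix_of_mem hω (ω.mem_cylinder_take n) (by rwa [length_take]))

/-- Domains are closed, so the cylinder of a long initial segment of ω is disjoint from the domain
of e; an element with empty domain is zero. -/
lemma eventually_mul_idem_take_eq_zero (hsrc : T.NoSources) {e : T.SGE} {ω : T.InfPath}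
    (hω : ω ∉ SGE.dom e) : ∀ᶠ n in Filter.atTop, e * SGE.idem (ω.take n) = 0 := by
  obtain ⟨N, hN⟩ := exists_agreeSet_subset (SGE.isClosed_dom e).isOpen_compl hω
  filter_upwards [Filter.eventually_ge_atTop N] with n hn
  by_contra h0
  obtain ⟨η, hη⟩ := SGE.dom_nonempty hsrc h0
  rw [SGE.mem_dom_mul_idem (SGE.isIdempotentElem_idem _), SGE.dom_idem, cylinder_take] at hη
  exact hN (agreeSet_anti _ hn hη.1) hη.2

/-- The tight filter of the idempotents `(α, 1, α)` with `α` an initial segment of `ω`. -/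
def toTightFilter (hsrc : T.NoSources) (ω : T.InfPath) : TightFilter T.SGE where
  carrier := {e | IsIdempotentElem e ∧ ω ∈ SGE.dom e}
  idem _ h := h.1
  nonempty := ⟨SGE.idem (ω.take 0), SGE.isIdempotentElem_idem _, ω.mem_cylinder_take 0⟩
  zero_notMem h := h.2
  mul_mem e he f hf := ⟨idem_mul he.1 hf.1, (SGE.mem_dom_mul_idem hf.1).2 ⟨hf.2, he.2⟩⟩
  mem_of_le e he f hf hef := ⟨hf, SGE.dom_subset_of_mul_eq hf hef he.2⟩
  tight X Y Z hX hY hZ hXω hYi hYd hZc := by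
    by_contra hne
    have hZω : ∀ z ∈ Z, ω ∉ SGE.dom z := fun z hz hωz =>
      hne ⟨z, hz, (hZc.1 hz).1, hωz⟩
    -- If ω avoided all domains of Z, a single long initial segment of ω would be below all of X and
    -- orthogonal to all of Y and of Z, so Z would not be a cover. Finiteness of the three sets
    -- permits a common length.
    have h₁ := (Filter.eventually_all_finite hX).2 fun x hx =>
      eventually_idem_take_mul (hXω hx).1 (hXω hx).2
    have h₂ := (Filter.eventually_all_finite hY).2 fun y hy =>
      eventually_mul_idem_take_eq_zero hsrc (e := y) (ω := ω) fun h =>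
        Set.disjoint_left.1 hYd hy ⟨hYi y hy, h⟩
    have h₃ := (Filter.eventually_all_finite hZ).2 fun z hz =>
      eventually_mul_idem_take_eq_zero hsrc (hZω z hz)
    obtain ⟨n, hn₁, hn₂, hn₃⟩ := (h₁.and (h₂.and h₃)).exists
    have hi := SGE.isIdempotentElem_idem (ω.take n)
    obtain ⟨z, hz, hzn⟩ := hZc.2 _ ⟨hi, hn₁, fun y hy => by
      rw [idem_comm _ _ hi (hYi y hy), hn₂ y hy]⟩ (SGE.idem_ne_zero _)
    exact hzn (hn₃ z hz)

lemma toTightFilter_injective (hsrc : T.NoSources) :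
    Function.Injective (toTightFilter (T := T) hsrc) := by
  intro ω η h
  refine eq_of_agree fun n => ?_
  have : SGE.idem (η.take n) ∈ (ω.toTightFilter hsrc).carrier := by
    rw [h]
    exact ⟨SGE.isIdempotentElem_idem _, η.mem_cylinder_take n⟩
  rw [← cylinder_take]
  exact this.2

end InfPath

/-- The product of two members of ξ is again in ξ, hence nonzero, and so has a point in its domain.
This is what makes the finite paths occurring in ξ compatible. -/
lemma exists_mem_cylinder_inter (hsrc : T.NoSources) {ξ : TightFilter T.SGE} {α β : T.FinPath}
    (hα : SGE.idem α ∈ ξ.carrier) (hβ : SGE.idem β ∈ ξ.carrier) :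
    ∃ ω, ω ∈ α.cylinder ∧ ω ∈ β.cylinder := by
  have h0 : SGE.idem α * SGE.idem β ≠ 0 := fun h =>
    ξ.zero_notMem (h ▸ ξ.mul_mem _ hα _ hβ)
  obtain ⟨ω, hω⟩ := SGE.dom_nonempty hsrc h0
  rw [SGE.mem_dom_mul_idem (SGE.isIdempotentElem_idem _)] at hω
  exact ⟨ω, hω.2, hω.1⟩

/-- The only use of tightness. By row-finiteness the one-edge extensions of α form a finite set, and
it covers everything below α, because any infinite path in Z(α) continues α by some edge. Thus ξ
contains one of the extensions. -/
lemma exists_append_mem (hrow : T.RowFinite) (hsrc : T.NoSources) {ξ : TightFilter T.SGE}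
    {α : T.FinPath} (hα : SGE.idem α ∈ ξ.carrier) :
    ∃ (a : E1) (h : T.r a = α.src), SGE.idem (α.append [a] ⟨h, trivial⟩) ∈ ξ.carrier := by
  have hfin : {e : T.SGE | ∃ (a : E1) (h : T.r a = α.src),
      e = SGE.idem (α.append [a] ⟨h, trivial⟩)}.Finite := by
    have : Finite {a : E1 // T.r a = α.src} := (hrow α.src).to_subtype
    refine (Set.finite_range fun a : {a : E1 // T.r a = α.src} =>
      SGE.idem (α.append [a.1] ⟨a.2, trivial⟩)).subset ?_
    rintro _ ⟨a, h, rfl⟩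
    exact ⟨⟨a, h⟩, rfl⟩
  have hpre : ∀ (a : E1) (h : T.r a = α.src), α.IsPrefix (α.append [a] ⟨h, trivial⟩) :=
    fun a h => ⟨rfl, List.prefix_append _ _⟩
  obtain ⟨_, ⟨a, h, rfl⟩, ha⟩ := ξ.tight {SGE.idem α} ∅ _ (Set.finite_singleton _)
    Set.finite_empty hfin (Set.singleton_subset_iff.2 hα) (by simp) (Set.empty_disjoint _) (by
      constructor
      · rintro _ ⟨a, h, rfl⟩
        refine ⟨SGE.isIdempotentElem_idem _, ?_, by simp⟩
        rintro _ rfl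
        exact SGE.idem_mul_idem (hpre a h)
      · rintro e ⟨he, hle, -⟩ he0
        obtain ⟨ω, hω⟩ := SGE.dom_nonempty hsrc he0
        have hωα : ω ∈ α.cylinder :=
          SGE.dom_subset_of_mul_eq (SGE.isIdempotentElem_idem α) (hle _ rfl) hω
        have ha : T.r (ω.edges α.edges.length) = α.src := by
          rw [← InfPath.src_take, ← InfPath.eq_take hωα]
        refine ⟨_, ⟨_, ha, rfl⟩, SGE.ne_zero_of_mem_dom (ω := ω)
          ((SGE.mem_dom_mul_idem he).2 ⟨hω, ?_⟩)⟩
        rw [SGE.dom_idem, InfPath.mem_cylinder_iff]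
        rw [InfPath.mem_cylinder_iff] at hωα
        refine ⟨hωα.1, fun i hi => ?_⟩
        simp only [FinPath.append, List.length_append, List.length_singleton] at hi ⊢
        rcases Nat.lt_succ_iff_lt_or_eq.1 hi with hi | rfl
        · rw [List.getElem_append_left hi, hωα.2 i hi]
        · simp)
  exact ⟨a, h, ha⟩

/-- A tight filter contains an idempotent of every length: cut a member down to length 0, then
extend edge by edge. These paths are pairwise compatible and have a common infinite prolongation ω,
whose initial segments are exactly the paths in ξ. -/
lemma InfPath.toTightFilter_surjective (hrow : T.RowFinite) (hsrc : T.NoSources) :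
    Function.Surjective (toTightFilter (T := T) hsrc) := by
  intro ξ
  have hex : ∀ n : ℕ, ∃ α : T.FinPath, α.edges.length = n ∧ SGE.idem α ∈ ξ.carrier := by
    intro n
    induction n with
    | zero =>
      obtain ⟨e, he⟩ := ξ.nonempty
      obtain ⟨α, rfl⟩ := SGE.exists_idem (ξ.idem e he) fun h => ξ.zero_notMem (h ▸ he)
      exact ⟨⟨α.rng, [], trivial⟩, rfl, ξ.mem_of_le _ he _ (SGE.isIdempotentElem_idem _)
        (SGE.idem_mul_idem ⟨rfl, List.nil_prefix⟩)⟩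
    | succ n ih =>
      obtain ⟨α, rfl, hα⟩ := ih
      obtain ⟨a, h, ha⟩ := exists_append_mem hrow hsrc hα
      exact ⟨_, by simp [FinPath.append], ha⟩
  choose p hlen hp using hex
  -- Compatibility makes the choice of p (n + 1) immaterial: by `hf` any chosen path of length
  -- greater than n has the same n-th edge.
  let f : ℕ → E1 := fun n => (p (n + 1)).edges[n]'(by rw [hlen]; exact Nat.lt_succ_self n)
  have hf : ∀ N, ∀ η ∈ (p N).cylinder, ∀ i < N, η.edges i = f i := by
    intro N η hη i hi
    obtain ⟨ζ, h₁, h₂⟩ := exists_mem_cylinder_inter hsrc (hp N) (hp (i + 1))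
    rw [cylinder_eq_agreeSet h₁, hlen] at hη
    rw [hη.2 i hi]
    exact (mem_cylinder_iff.1 h₂).2 i (by rw [hlen]; exact Nat.lt_succ_self i)
  let ω : T.InfPath := ⟨f, fun n => by
    obtain ⟨η, hη⟩ := hsrc.cylinder_nonempty (p (n + 2))
    rw [← hf _ η hη n (by omega), ← hf _ η hη (n + 1) (by omega), η.isPath]⟩
  -- The length N + 1 instead of N guarantees a first edge, which is needed to compare ranges when N
  -- = 0.
  have hagree : ∀ N, ∀ η ∈ (p (N + 1)).cylinder, ω ∈ η.agreeSet N := by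
    intro N η hη
    refine ⟨?_, fun i hi => (hf _ η hη i (by omega)).symm⟩
    change T.r (f 0) = T.r (η.edges 0)
    rw [hf _ η hη 0 (by omega)]
  have hmem : ∀ α : T.FinPath, SGE.idem α ∈ ξ.carrier → ω ∈ α.cylinder := by
    intro α hα
    obtain ⟨η, h₁, h₂⟩ := exists_mem_cylinder_inter hsrc hα (hp (α.edges.length + 1))
    exact mem_cylinder_of_agree h₁ (hagree _ η h₂)
  refine ⟨ω, TightFilter.ext' (Set.ext fun e => ⟨?_, fun he => ?_⟩)⟩
  · rintro ⟨he, hωe⟩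
    obtain ⟨α, rfl⟩ := SGE.exists_idem he (SGE.ne_zero_of_mem_dom hωe)
    have h₁ := eq_take (hmem _ (hp α.edges.length))
    rw [hlen, ← eq_take hωe] at h₁
    exact h₁ ▸ hp _
  · obtain ⟨α, rfl⟩ := SGE.exists_idem (ξ.idem e he) fun h => ξ.zero_notMem (h ▸ he)
    exact ⟨SGE.isIdempotentElem_idem α, hmem α he⟩

/-- Infinite paths correspond to tight filters. -/
noncomputable def tightEquiv (hrow : T.RowFinite) (hsrc : T.NoSources) :
    T.InfPath ≃ TightFilter T.SGE :=
  Equiv.ofBijective (InfPath.toTightFilter hsrc)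
    ⟨InfPath.toTightFilter_injective hsrc, InfPath.toTightFilter_surjective hrow hsrc⟩

/-- The space of infinite paths is homeomorphic to the space of tight filters. -/
noncomputable def tightHomeo (hrow : T.RowFinite) (hsrc : T.NoSources) :
    T.InfPath ≃ₜ TightFilter T.SGE where
  toEquiv := tightEquiv hrow hsrc
  continuous_toFun := by
    have hop : ∀ e : T.SGE, IsOpen {ω : T.InfPath | IsIdempotentElem e ∧ ω ∈ SGE.dom e} ∧
        IsOpen {ω : T.InfPath | ¬ (IsIdempotentElem e ∧ ω ∈ SGE.dom e)} := by
      intro e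
      by_cases he : IsIdempotentElem e
      · simp only [he, true_and]
        exact ⟨SGE.isOpen_dom e, (SGE.isClosed_dom e).isOpen_compl⟩
      · simp [he]
    refine continuous_generateFrom_iff.2 ?_
    rintro _ ⟨e, rfl | rfl⟩
    · exact (hop e).1
    · exact (hop e).2
  continuous_invFun := by
    refine continuous_generateFrom_iff.2 ?_
    rintro _ ⟨α, rfl⟩
    have : IsOpen {ξ : TightFilter T.SGE | SGE.idem α ∈ ξ.carrier} :=
      TopologicalSpace.isOpen_generateFrom_of_mem ⟨_, Or.inl rfl⟩
    convert this using 1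
    ext ξ
    obtain ⟨ω, rfl⟩ := (tightEquiv hrow hsrc).surjective ξ
    change (tightEquiv hrow hsrc).symm (tightEquiv hrow hsrc ω) ∈ α.cylinder ↔ _
    rw [Equiv.symm_apply_apply]
    exact ⟨fun h => ⟨SGE.isIdempotentElem_idem α, h⟩, fun h => h.2⟩

/-- An idempotent f lies in the filter of sω exactly when sω ∈ dom f, i.e. when ω lies in the domain
of s* f s; this is the defining condition of the conjugated filter. -/
lemma intertwines_tightHomeo (hrow : T.RowFinite) (hsrc : T.NoSources) :
    T.pathAction.Intertwines (TightFilter.action T.SGE) (tightHomeo hrow hsrc) := by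
  have hmem : ∀ (s : T.SGE) (ω : T.InfPath),
      ω ∈ SGE.dom s ↔ star s * s ∈ (ω.toTightFilter hsrc).carrier := fun s ω =>
    ⟨fun h => ⟨idem_star_mul s, T.pathAction.mem_star_mul h⟩,
      fun h => (SGE.mem_dom_mul.1 h.2).1⟩
  refine ⟨hmem, fun s ω hω => TightFilter.ext' ?_⟩
  classical
  change ((SGE.act s ω).toTightFilter hsrc).carrier =
    (if h : star s * s ∈ (ω.toTightFilter hsrc).carrier
      then TightFilter.conj s (ω.toTightFilter hsrc) h else ω.toTightFilter hsrc).carrier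
  rw [dif_pos ((hmem s ω).1 hω)]
  ext f
  constructor
  · rintro ⟨hf, h⟩
    exact ⟨hf, idem_conj s hf, (SGE.mem_dom_conj hf).2 ⟨hω, h⟩⟩
  · rintro ⟨hf, -, h⟩
    exact ⟨hf, ((SGE.mem_dom_conj hf).1 h).2⟩

end SelfSimilarGraph

/-! ### From a contracting groupoid to circuits with entries -/

namespace SelfSimilarGraph

variable {G E0 E1 : Type*} [Group G] [MulAction G E0] [MulAction G E1]
  {T : SelfSimilarGraph G E0 E1}

/-- The cocycle changes the group element from edge to edge, but each edge is still moved within its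
G-orbit; this is why orbits of vertices are invariants of tails. -/
lemma exists_seqAct_eq_smul (g : G) (η : ℕ → E1) (n : ℕ) : ∃ h : G, T.seqAct g η n = h • η n := by
  induction n generalizing g η with
  | zero => exact ⟨g, rfl⟩
  | succ n ih => exact ih (T.φ g (η 0)) fun k => η (k + 1)

/-- At each vertex along l the edge of l is the only one available, so an infinite path with range x
is forced to follow l. -/
lemma exists_eq_conc_of_unique (x : E0) (l : List E1) (hl : T.IsPath x l)
    (hu : ∀ b ∈ l, ∀ a, T.r a = T.r b → a = b) (f : ℕ → E1) (h0 : T.r (f 0) = x)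
    (hf : ∀ n, T.s (f n) = T.r (f (n + 1))) : ∃ η, f = conc l η := by
  induction l generalizing x f with
  | nil => exact ⟨f, rfl⟩
  | cons a l ih =>
    have ha : f 0 = a := hu a (by simp) _ (h0.trans hl.1.symm)
    obtain ⟨η, hη⟩ := ih (T.s a) hl.2 (fun b hb => hu b (by simp [hb])) (fun n => f (n + 1))
      (by rw [← ha, hf]) fun n => hf (n + 1)
    refine ⟨η, funext fun n => ?_⟩
    cases n with
    | zero => exact ha
    | succ n => exact congrFun hη n

/-- If a `G`-circuit has no entry then its range emits a single infinite path. -/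
lemma IsGCircuit.infPath_unique {g : G} {γ : T.FinPath} (hγ : T.IsGCircuit g γ)
    (hent : ¬ T.HasEntry γ) {ω η : T.InfPath} (hω : ω.rng = γ.rng) (hη : η.rng = γ.rng) :
    η = ω := by
  have hu : ∀ b ∈ γ.edges, ∀ a, T.r a = T.r b → a = b := by
    intro b hb a hab
    by_contra hne
    exact hent ⟨b, hb, a, hab, hne⟩
  have hcyl : ∀ ζ : T.InfPath, ζ.rng = γ.rng → ζ ∈ γ.cylinder := fun ζ hζ =>
    InfPath.mem_cylinder.2 ⟨hζ,
      exists_eq_conc_of_unique γ.rng γ.edges γ.isPath hu ζ.edges hζ ζ.isPath⟩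
  have hpos : 0 < γ.edges.length := List.length_pos_iff.2 hγ.1
  have key : ∀ n, ∀ ω η : T.InfPath, ω.rng = γ.rng → η.rng = γ.rng →
      ∀ i < n, η.edges i = ω.edges i := by
    intro n
    induction n with
    | zero => intro _ _ _ _ i hi; exact absurd hi (Nat.not_lt_zero i)
    | succ n ih =>
      intro ω η hω hη i hi
      have hω' := hcyl ω hω
      have hη' := hcyl η hη
      by_cases hiγ : i < γ.edges.length
      · rw [(InfPath.mem_cylinder_iff.1 hω').2 i hiγ, (InfPath.mem_cylinder_iff.1 hη').2 i hiγ]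
      · have hrng : ∀ ζ ∈ γ.cylinder,
            (InfPath.smul g⁻¹ (InfPath.drop γ.edges.length ζ)).rng = γ.rng := by
          intro ζ hζ
          rw [InfPath.rng_smul, ← InfPath.src_eq_rng_drop hζ, hγ.2, inv_smul_smul]
        -- After γ the tails have range s(γ) = g r(γ), so their translates by g⁻¹ start at r(γ)
        -- again and the induction hypothesis applies; acting by g recovers the tails. As |γ| > 0,
        -- the index has dropped.
        have h₁ := T.seqAct_congr g (ih _ _ (hrng ω hω') (hrng η hη')) (i - γ.edges.length)
          (by omega)
        simp only [InfPath.smul, T.seqAct_inv, InfPath.drop,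
          Nat.sub_add_cancel (not_lt.1 hiγ)] at h₁
        exact h₁
  exact InfPath.ext (funext fun n => key (n + 1) ω η hω hη n (Nat.lt_succ_self n))

/-- The orbit of the `n`-th vertex of an infinite path. -/
def InfPath.vertexOrbit (ω : T.InfPath) (n : ℕ) : MulAction.orbitRel.Quotient G E0 :=
  Quotient.mk _ (T.r (ω.edges n))

lemma orbit_mk_smul (g : G) (x : E0) :
    (Quotient.mk _ (g • x) : MulAction.orbitRel.Quotient G E0) = Quotient.mk _ x :=
  Quotient.sound ⟨g, rfl⟩

/-- Without `G`-circuits reachable from its range, an infinite path visits each orbit of vertices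
at most once. -/
lemma InfPath.vertexOrbit_injective {x : E0}
    (hx : ∀ α : T.FinPath, α.rng = x → ∀ (g : G) (γ : T.FinPath), T.IsGCircuit g γ →
      α.src ≠ γ.rng) {ω : T.InfPath} (hω : ω.rng = x) : Function.Injective ω.vertexOrbit := by
  have key : ∀ i j, i < j → ω.vertexOrbit i ≠ ω.vertexOrbit j := by
    intro i j hij h
    obtain ⟨g, hg⟩ := Quotient.exact h.symm
    -- If the i-th and j-th vertices satisfy r(ω_j) = g r(ω_i), the segment of ω between them
    -- together with g is a G-circuit, reached along the first i edges.
    refine hx (ω.take i) hω g ((ω.drop i).take (j - i)) ⟨fun h0 => ?_, ?_⟩ ?_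
    · have := congrArg List.length h0
      rw [length_take, List.length_nil] at this
      omega
    · rw [src_take]
      change T.r (ω.edges (j - i + i)) = g • T.r (ω.edges (0 + i))
      rw [Nat.sub_add_cancel hij.le, zero_add]
      exact hg.symm
    · rw [src_take]
      change T.r (ω.edges i) = T.r (ω.edges (0 + i))
      rw [zero_add]
  intro i j h
  rcases lt_trichotomy i j with hij | hij | hij
  · exact (key i j hij h).elim
  · exact hij
  · exact (key j i hij h.symm).elim

namespace SGE

lemma act_edges_lt {α : T.FinPath} {g : G} {β : T.FinPath} {e} {ω : T.InfPath}
    (h : ω ∈ β.cylinder) {i : ℕ} (hi : i < α.edges.length) :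
    (act (triple α g β e) ω).edges i = α.edges[i] :=
  (InfPath.mem_cylinder_iff.1 (act_mem h)).2 i hi

lemma act_edges_add {α : T.FinPath} {g : G} {β : T.FinPath} {e} {ω : T.InfPath}
    (h : ω ∈ β.cylinder) (j : ℕ) : (act (triple α g β e) ω).edges (j + α.edges.length) =
      T.seqAct g (fun k => ω.edges (k + β.edges.length)) j := by
  obtain ⟨-, η, hη⟩ := InfPath.mem_cylinder.1 h
  rw [act_edges h hη, conc_add]
  congr 1
  funext k
  rw [hη, conc_add]

/-- Applying (α, g, β) shifts the sequence of vertex orbits by |α| - |β| and changes it only in the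
first |α| places. -/
lemma vertexOrbit_act {α : T.FinPath} {g : G} {β : T.FinPath} {e} {ω : T.InfPath}
    (h : ω ∈ β.cylinder) (j : ℕ) : (act (triple α g β e) ω).vertexOrbit (j + α.edges.length) =
      ω.vertexOrbit (j + β.edges.length) := by
  obtain ⟨k, hk⟩ := exists_seqAct_eq_smul (T := T) g (fun k => ω.edges (k + β.edges.length)) j
  rw [InfPath.vertexOrbit, act_edges_add h, hk, T.r_smul, orbit_mk_smul]
  rfl

/-- The first n edges of gη depend only on the first n edges of η, so exchanging β for α exchanges
agreement up to n + |β| for agreement up to n + |α|. -/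
lemma act_mem_agreeSet {α : T.FinPath} {g : G} {β : T.FinPath} {e} {ω η : T.InfPath}
    (h : ω ∈ β.cylinder) {n : ℕ} (hη : η ∈ ω.agreeSet (n + β.edges.length)) :
    act (triple α g β e) η ∈ (act (triple α g β e) ω).agreeSet (n + α.edges.length) := by
  have hηβ : η ∈ β.cylinder :=
    InfPath.mem_cylinder_of_agree h (InfPath.agreeSet_anti _ (Nat.le_add_left _ _) hη)
  refine ⟨by rw [act_rng h, act_rng hηβ], fun i hi => ?_⟩
  by_cases hiα : i < α.edges.length
  · rw [act_edges_lt h hiα, act_edges_lt hηβ hiα]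
  · obtain ⟨j, rfl⟩ := Nat.exists_eq_add_of_le' (not_lt.1 hiα)
    rw [act_edges_add h, act_edges_add hηβ]
    exact T.seqAct_congr g (N := n) (fun k hk => hη.2 _ (by omega)) j (by omega)

/-- Apply `act_mem_agreeSet` to the inverse triple (β, g⁻¹, α). -/
lemma agreeSet_act_subset {α : T.FinPath} {g : G} {β : T.FinPath} {e} {ω : T.InfPath}
    (h : ω ∈ β.cylinder) (n : ℕ) :
    (act (triple α g β e) ω).agreeSet (n + α.edges.length) ⊆
      act (triple α g β e) '' ω.agreeSet (n + β.edges.length) := by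
  intro ζ hζ
  have hα := act_mem (e := e) h
  have hζα : ζ ∈ α.cylinder :=
    InfPath.mem_cylinder_of_agree hα (InfPath.agreeSet_anti _ (Nat.le_add_left _ _) hζ)
  have h₁ := act_mem_agreeSet (g := g⁻¹) (α := β) (e := by rw [e, inv_smul_smul]) hα hζ
  have h₂ : act (star (triple α g β e)) (act (triple α g β e) ω) = ω := act_star_act h
  have h₃ : act (star (star (triple α g β e))) (act (star (triple α g β e)) ζ) = ζ :=
    act_star_act (s := star (triple α g β e)) hζα
  rw [star_triple] at h₂
  rw [h₂] at h₁
  rw [InverseSemigroup.star_star'] at h₃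
  exact ⟨_, h₁, h₃⟩

end SGE

/-- The image is nonempty, so if it lies in a one-point set it is all of it. -/
lemma not_subsingleton_of_image_ssubset {X : Type*} [TopologicalSpace X] {V : Set X} {τ : X → X}
    (hne : V.Nonempty) (h : τ '' closure V ⊂ V) : ¬ V.Subsingleton := by
  intro hs
  obtain ⟨v, hv⟩ := hne
  refine h.2 fun w hw => ?_
  have hτ : τ v ∈ τ '' closure V := ⟨v, subset_closure hv, rfl⟩
  rwa [hs hw (h.1 hτ)]

/-- Suppose that `τ` maps a set `V` of infinite paths into itself and is given on `V` by finitely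
many elements of the inverse semigroup, and that no `G`-circuit is reachable from `x`. Then the
iterates under `τ` of a point `ω` outside of the image of `τ` return close to each other, which is
impossible for injective `τ`. -/
lemma subset_image_of_finite_pieces (hrow : T.RowFinite) {x : E0}
    (hx : ∀ α : T.FinPath, α.rng = x → ∀ (g : G) (γ : T.FinPath), T.IsGCircuit g γ →
      α.src ≠ γ.rng) {V : Set T.InfPath} {τ : T.InfPath → T.InfPath} (hVo : IsOpen V)
    (hV : ∀ ω ∈ V, ω.rng = x) (hinj : InjOn τ V) (hmaps : MapsTo τ V V)
    {D : Set T.FinPath} (hD : D.Finite) (hVD : ∀ ω ∈ V, ∃ ν ∈ D, ω ∈ ν.cylinder)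
    (hτ : ∀ ν ∈ D, ∃ α g β, ∃ e : α.src = g • β.src, β.edges.length ≤ ν.edges.length ∧
      ν.cylinder ⊆ β.cylinder ∧ ∀ η ∈ ν.cylinder, τ η = SGE.act (.triple α g β e) η) :
    V ⊆ τ '' V := by
  classical
  intro ω hω
  choose! a g b e hlen hcyl hact using hτ
  let P : Set (MulAction.orbitRel.Quotient G E0) := (fun ν : T.FinPath => Quotient.mk _ ν.src) '' D
  have hP : P.Finite := hD.image _
  -- P consists of the orbits of the sources of the pieces. Since ω meets each orbit at most once,
  -- no orbit in P occurs on ω after position n₁; the second bound n₂ makes the cylinder of length n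
  -- at ω lie in V.
  obtain ⟨n₁, hn₁⟩ := (hP.preimage
    (InfPath.vertexOrbit_injective hx (hV ω hω)).injOn).bddAbove
  obtain ⟨n₂, hn₂⟩ := InfPath.exists_agreeSet_subset hVo hω
  let n := max n₁ n₂
  have hnV : ω.agreeSet n ⊆ V := (ω.agreeSet_anti (le_max_right _ _)).trans hn₂
  have hnP : ∀ m, 0 < m → ω.vertexOrbit (n + m) ∉ P := fun m hm hmem => by
    have h₁ : n + m ≤ n₁ := hn₁ hmem
    have h₂ : n₁ ≤ n := le_max_left _ _
    omega
  let Q : Set (MulAction.orbitRel.Quotient G E0) :=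
    -- Q collects every orbit that can occur before the tail inherited from ω: the orbits on the
    -- finitely many prefixes a ν that τ can insert, and those among the first n vertices of ω.
    (⋃ ν ∈ D, (fun c : E1 => Quotient.mk _ (T.r c)) '' {c | c ∈ (a ν).edges}) ∪
      ω.vertexOrbit '' Iio n
  have hQ : Q.Finite := (hD.biUnion fun ν _ => ((a ν).edges.finite_toSet).image _).union
    ((finite_Iio n).image _)
  -- Three invariants of the k-th iterate: from N on its orbits are those of ω from n on, before N
  -- they lie in Q, and every path agreeing with it up to N is an image under τ^k of a path close to
  -- ω.
  have step : ∀ k, ∃ N, (∀ m, (τ^[k] ω).vertexOrbit (N + m) = ω.vertexOrbit (n + m)) ∧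
      (∀ i < N, (τ^[k] ω).vertexOrbit i ∈ Q) ∧
      (τ^[k] ω).agreeSet N ⊆ τ^[k] '' ω.agreeSet n := by
    intro k
    induction k with
    | zero =>
      exact ⟨n, fun _ => rfl, fun i hi => Or.inr ⟨i, hi, rfl⟩, by simp⟩
    | succ k ih =>
      obtain ⟨N, h₁, h₂, h₃⟩ := ih
      rw [Function.iterate_succ_apply']
      have hkV : τ^[k] ω ∈ V := hmaps.iterate k hω
      set η := τ^[k] ω with hη
      obtain ⟨ν, hν, hην⟩ := hVD η hkV
      -- Otherwise the source of ν would be a vertex of the iterate strictly beyond N, and its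
      -- orbit, a member of P, would occur on ω beyond n. So τ rewrites the iterate only before N.
      have hνN : ν.edges.length ≤ N := by
        by_contra hlt
        obtain ⟨m, hm⟩ := Nat.exists_eq_add_of_lt (not_le.1 hlt)
        refine hnP (m + 1) (Nat.succ_pos m) ?_
        rw [← h₁]
        refine ⟨ν, hν, ?_⟩
        simp only [InfPath.vertexOrbit]
        rw [← InfPath.src_take, ← add_assoc, ← hm, ← InfPath.eq_take hην]
      have hbN : (b ν).edges.length ≤ N := (hlen ν hν).trans hνN
      obtain ⟨M, rfl⟩ := Nat.exists_eq_add_of_le' hbN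
      have hηb : η ∈ (b ν).cylinder := hcyl ν hν hην
      rw [hact ν hν η hην]
      refine ⟨M + (a ν).edges.length, fun m => ?_, fun i hi => ?_, ?_⟩
      · rw [← h₁, add_right_comm, SGE.vertexOrbit_act hηb, add_right_comm]
      · by_cases hia : i < (a ν).edges.length
        · refine Or.inl (mem_biUnion hν ⟨_, List.getElem_mem hia, ?_⟩)
          rw [InfPath.vertexOrbit, SGE.act_edges_lt hηb hia]
        · obtain ⟨j, rfl⟩ := Nat.exists_eq_add_of_le' (not_lt.1 hia)
          rw [SGE.vertexOrbit_act hηb]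
          exact h₂ _ (by omega)
      · refine (SGE.agreeSet_act_subset hηb M).trans ?_
        rintro _ ⟨ζ, hζ, rfl⟩
        have hζν : ζ ∈ ν.cylinder :=
          InfPath.mem_cylinder_of_agree hην (InfPath.agreeSet_anti _ hνN hζ)
        rw [← hact ν hν ζ hζν]
        obtain ⟨ξ, hξ, rfl⟩ := h₃ hζ
        exact ⟨ξ, hξ, Function.iterate_succ_apply' _ _ _⟩
  choose N h₁ h₂ h₃ using step
  have hiter : ∀ k, τ^[k] ω ∈ V := fun k => hmaps.iterate k hω
  -- The first N k vertices of the iterate have pairwise distinct orbits, all in Q.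
  have hNQ : ∀ k, N k ≤ Q.ncard := by
    intro k
    have hi := InfPath.vertexOrbit_injective hx (hV _ (hiter k))
    have := ncard_le_ncard (s := (τ^[k] ω).vertexOrbit '' Iio (N k)) (t := Q)
      (by rintro _ ⟨i, hi, rfl⟩; exact h₂ k i hi) hQ
    rwa [ncard_image_of_injective _ hi, ← Finset.coe_Iio, ncard_coe_finset, Nat.card_Iio] at this
  -- Finitely many cylinders of length |Q| cover all paths with range x, so two of the iterates
  -- share one by the pigeonhole principle.
  obtain ⟨F, -, hF⟩ := (hrow.isCompact_rng x).elim_nhds_subcover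
    (fun η => η.agreeSet Q.ncard)
    fun η _ => (η.isOpen_agreeSet _).mem_nhds (η.mem_agreeSet_self _)
  have hcov : ∀ k, ∃ η ∈ F, τ^[k] ω ∈ η.agreeSet Q.ncard := fun k => by
    simpa using hF (hV _ (hiter k))
  choose c hcF hc using hcov
  obtain ⟨k, l, hkl, hc', hN⟩ : ∃ k l, k < l ∧ c k = c l ∧ N k = N l := by
    obtain ⟨k, -, l, -, hne, heq⟩ := infinite_univ.exists_ne_map_eq_of_mapsTo
      (f := fun k => (c k, N k)) (t := (F : Set T.InfPath) ×ˢ Iic Q.ncard)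
      (fun k _ => ⟨hcF k, hNQ k⟩) (F.finite_toSet.prod (finite_Iic _))
    obtain ⟨h₁, h₂⟩ := Prod.mk.inj heq
    rcases hne.lt_or_gt with h | h
    · exact ⟨k, l, h, h₁, h₂⟩
    · exact ⟨l, k, h, h₁.symm, h₂.symm⟩
  have hmem : τ^[k] ω ∈ (τ^[l] ω).agreeSet (N l) := by
    refine InfPath.agreeSet_anti _ (hNQ l) (InfPath.agreeSet_trans (InfPath.agreeSet_symm (hc l)) ?_)
    rw [← hc']
    exact hc k
  obtain ⟨ζ, hζ, hζk⟩ := h₃ l hmem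
  obtain ⟨d, rfl⟩ := Nat.exists_eq_add_of_lt hkl
  have hinjk : InjOn τ^[k] V := hinj.iterate hmaps k
  -- With l = k + (d + 1) the equation reads τ^k(τ^(d+1) ζ) = τ^k ω; cancelling τ^k leaves ω = τ(τ^d
  -- ζ).
  rw [add_assoc, Function.iterate_add_apply] at hζk
  have h := hinjk (hmaps.iterate _ (hnV hζ)) hω hζk
  rw [Function.iterate_succ_apply'] at h
  exact ⟨_, hmaps.iterate d (hnV hζ), h⟩

/-- Contraction inside Z(α) rules out circuits without an entry at s(α), as they make Z(α) a point.
If no circuit is reachable from x either, contraction inside Z(x) contradicts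
`subset_image_of_finite_pieces`. -/
lemma exists_gcircuit_of_isPiecewiseContracting (hrow : T.RowFinite) (hsrc : T.NoSources)
    (h : T.pathAction.IsPiecewiseContracting) (x : E0) :
    ∃ α : T.FinPath, α.rng = x ∧
      ∃ (g : G) (γ : T.FinPath), T.IsGCircuit g γ ∧ T.HasEntry γ ∧ α.src = γ.rng := by
  by_contra hno
  have hx : ∀ α : T.FinPath, α.rng = x → ∀ (g : G) (γ : T.FinPath), T.IsGCircuit g γ →
      α.src ≠ γ.rng := by
    intro α hα g γ hγ hαγ
    have hent : ¬ T.HasEntry γ := fun hent => hno ⟨α, hα, g, γ, hγ, hent, hαγ⟩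
    obtain ⟨V, τ, -, hVne, hVα, -, -, hlt⟩ :=
      h α.cylinder (InfPath.isOpen_cylinder α) (hsrc.cylinder_nonempty α)
    refine not_subsingleton_of_image_ssubset hVne hlt fun ω hω η hη => ?_
    obtain ⟨ω', h₁, rfl⟩ := hVα hω
    obtain ⟨η', h₂, rfl⟩ := hVα hη
    have := hγ.infPath_unique hent (h₂.symm.trans hαγ) (h₁.symm.trans hαγ)
    subst this
    rfl
  let o : T.FinPath := ⟨x, [], trivial⟩
  obtain ⟨V, τ, hVo, -, hVx, hinj, hloc, hlt⟩ :=
    h o.cylinder (InfPath.isOpen_cylinder o) (hsrc.cylinder_nonempty o)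
  have hclx : ∀ ω ∈ closure V, ω.rng = x := fun ω hω =>
    InfPath.rng_of_mem_cylinder (closure_minimal hVx (InfPath.isClosed_cylinder o) hω)
  have hcomp : IsCompact (closure V) :=
    (hrow.isCompact_rng x).of_isClosed_subset isClosed_closure hclx
  -- Shrink each neighbourhood on which τ is one triple to a cylinder at least as long as the
  -- triple's β, then keep finitely many of them by compactness of V̄.
  have hloc' : ∀ ω ∈ closure V, ∃ ν : T.FinPath, ω ∈ ν.cylinder ∧
      ∃ α g β, ∃ e : α.src = g • β.src, β.edges.length ≤ ν.edges.length ∧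
        ν.cylinder ⊆ β.cylinder ∧ ∀ η ∈ ν.cylinder, τ η = SGE.act (.triple α g β e) η := by
    intro ω hω
    obtain ⟨s, O, hO, hωO, hOs, hτ⟩ := hloc ω hω
    cases s with
    | zero => exact (hOs hωO).elim
    | triple α g β e =>
      obtain ⟨n, hn⟩ := InfPath.exists_agreeSet_subset hO hωO
      have hsub : (ω.take (max n β.edges.length)).cylinder ⊆ O := by
        rw [InfPath.cylinder_take]
        exact (ω.agreeSet_anti (le_max_left _ _)).trans hn
      refine ⟨ω.take (max n β.edges.length), ω.mem_cylinder_take _, α, g, β, e, ?_,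
        hsub.trans hOs, fun η hη => hτ η (hsub hη)⟩
      rw [InfPath.length_take]
      exact le_max_right _ _
  have : Nonempty T.FinPath := ⟨o⟩
  choose! ν hων hν using hloc'
  obtain ⟨F, hFV, hF⟩ := hcomp.elim_nhds_subcover (fun ω => (ν ω).cylinder)
    fun ω hω => (InfPath.isOpen_cylinder _).mem_nhds (hων ω hω)
  have hmaps : MapsTo τ V V := fun ω hω => hlt.1 ⟨ω, subset_closure hω, rfl⟩
  refine hlt.2 ((subset_image_of_finite_pieces hrow hx hVo
    (fun ω hω => hclx ω (subset_closure hω)) (hinj.mono subset_closure) hmaps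
    (F.finite_toSet.image ν) (fun ω hω => ?_) ?_).trans (image_mono subset_closure))
  · obtain ⟨η, hη, hωη⟩ := mem_iUnion₂.1 (hF (subset_closure hω))
    exact ⟨_, ⟨η, hη, rfl⟩, hωη⟩
  · rintro _ ⟨η, hη, rfl⟩
    exact hν η (hFV η hη)

end SelfSimilarGraph

/-! ### The equivalence -/

theorem theorem4p7 {G E0 E1 : Type*} [Group G] [MulAction G E0] [MulAction G E1]
    [Countable E0] [Countable E1] (T : SelfSimilarGraph G E0 E1)
    (hrow : T.RowFinite) (hsrc : T.NoSources) :
    List.TFAE [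
      InverseSemigroup.IsLocallyContracting T.SGE,
      T.pathAction.IsLocallyContracting,
      (InverseSemigroup.tightGroupoid T.SGE).IsLocallyContracting,
      ∀ x : E0, ∃ α : T.FinPath, α.rng = x ∧
        ∃ (g : G) (γ : T.FinPath), T.IsGCircuit g γ ∧ T.HasEntry γ ∧ α.src = γ.rng] := by
  tfae_have 4 → 1 := SelfSimilarGraph.isLocallyContracting_of_gcircuit hsrc
  tfae_have 1 → 2 := SelfSimilarGraph.pathAction_isLocallyContracting hsrc
  tfae_have 2 → 3 := fun h =>
    (h.of_intertwines (SelfSimilarGraph.intertwines_tightHomeo hrow hsrc)).germGroupoid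
  tfae_have 3 → 4 := fun h =>
    SelfSimilarGraph.exists_gcircuit_of_isPiecewiseContracting hrow hsrc
      ((InvSemigroupAction.isPiecewiseContracting_of_germGroupoid h).of_intertwines
        (SelfSimilarGraph.intertwines_tightHomeo hrow hsrc))
  tfae_finish
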